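/- **Theorem D.** Let $p$ be a prime. (1) *(Discrete case.)* Let $G$ be a finitely generated group and let $U$ be a normal subgroup of $G$ of index $p$. Put $H^{\mathrm{ab}}=H/[H,H]$, $\mathbb{Z}_\bullet=\mathbb{Z}$ and $\mathbb{Q}_\bullet=\mathbb{Q}$. (2) *(Pro-$p$ case.)* Let $G$ be a (topologically) finitely generated pro-$p$ group and let $U$ be a closed subgroup of $G$ of index $p$; such a $U$ is automatically normal in $G$. Put $H^{\mathrm{ab}}=H/\mathrm{cl}([H,H])$, where $\mathrm{cl}$ denotes the closure, with its canonical structure of a $\mathbb{Z}_p$-module, $\mathbb{Z}_\bullet=\mathbb{Z}_p$ and $\mathbb{Q}_\bullet=\mathbb{Q}_p$. In both cases, for $H=G$ and $H=U$, the space $H^{\mathrm{ab}}\otimes_{\mathbb{Z}_\bullet}\mathbb{Q}_\bullet$ has finite dimension over $\mathbb{Q}_\bullet$; let $\mathrm{tf}(H)$ be this dimension. Let $i_{G,U}\colon G^{\mathrm{ab}}\to U^{\mathrm{ab}}$ be the transfer; its image lies in the subgroup $(U^{\mathrm{ab}})^{G/U}$ of elements that are fixed by the action of $G/U$ by conjugation.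 Let $$\mathbf{tk}(G/U)=\ker(i_{G,U}),\qquad \mathbf{tc}(G/U)=\mathrm{coker}\bigl(G^{\mathrm{ab}}\xrightarrow{\,i_{G,U}\,}(U^{\mathrm{ab}})^{G/U}\bigr).$$ Then $\mathbf{tk}(G/U)$ and $\mathbf{tc}(G/U)$ are finite and, with the transfer ratio $\rho(G/U)=|\mathbf{tk}(G/U)|/|\mathbf{tc}(G/U)|$, $$\mathrm{tf}(U)=p\cdot\mathrm{tf}(G)+(1-p)\bigl(1-\log_p\rho(G/U)\bigr).$$ -/

import Mathlib

open scoped TensorProduct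

noncomputable section

namespace TransferRatio

/-! ### Two facts about the transfer homomorphism -/

section Transfer

variable {G : Type*} [Group G] {U : Subgroup G} {B : Type*} [CommGroup B]

open Classical in
/-- Extension of `ϕ : U →* B` to a function on `G`, with value `1` outside `U`. -/
def extendOne (ϕ : U →* B) (x : G) : B := if h : x ∈ U then ϕ ⟨x, h⟩ else 1

theorem extendOne_of_mem (ϕ : U →* B) {x : G} (h : x ∈ U) : extendOne ϕ x = ϕ ⟨x, h⟩ :=
  dif_pos h

/-- The transfer computed with an arbitrary section of `G → G ⧸ U`. -/
theorem transfer_eq_prod_section [U.FiniteIndex] [Fintype (G ⧸ U)] (ϕ : U →* B)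
    (f : G ⧸ U → G) (hf : ∀ q, (f q : G ⧸ U) = q) (g : G) :
    ϕ.transfer g = ∏ q : G ⧸ U, extendOne ϕ ((f q)⁻¹ * (g * f (g⁻¹ • q))) := by
  obtain rfl : ‹Fintype (G ⧸ U)› = U.fintypeQuotientOfFiniteIndex := Subsingleton.elim _ _
  rw [MonoidHom.transfer_def ϕ ⟨Set.range f, Subgroup.isComplement_range_left hf⟩ g]
  unfold Subgroup.leftTransversals.diff
  refine Finset.prod_congr rfl fun q _ => ?_
  have h1 := Subgroup.IsComplement.leftQuotientEquiv_apply hf q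
  have h2 := Subgroup.IsComplement.leftQuotientEquiv_apply hf (g⁻¹ • q)
  have h3 := Subgroup.smul_apply_eq_smul_apply_inv_smul g
    (⟨Set.range f, Subgroup.isComplement_range_left hf⟩ : U.LeftTransversal) q
  rw [h2] at h3
  have hmem : (f q)⁻¹ * (g * f (g⁻¹ • q)) ∈ U := by
    rw [← QuotientGroup.eq, hf, ← smul_eq_mul, ← MulAction.Quotient.smul_coe, hf, smul_inv_smul]
  rw [extendOne_of_mem ϕ hmem]
  congr 1
  apply Subtype.ext
  simp only [h1, h3, smul_eq_mul]

/-- The values of the transfer to a normal subgroup are invariant under conjugation. -/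
theorem transfer_invariant [U.FiniteIndex] [U.Normal] (ϕ : U →* B) (g : G) (c : B →* B)
    (hc : ∀ u : U, c (ϕ u) = ϕ (MulAut.conjNormal g u)) (x : G) :
    c (ϕ.transfer x) = ϕ.transfer x := by
  classical
  let _ := U.fintypeQuotientOfFiniteIndex
  have hcext : ∀ y : G, c (extendOne ϕ y) = extendOne ϕ (g * y * g⁻¹) := by
    intro y
    by_cases hy : y ∈ U
    · rw [extendOne_of_mem ϕ hy, hc, extendOne_of_mem ϕ (Subgroup.Normal.conj_mem ‹_› y hy g)]
      congr 1
    · have hy' : g * y * g⁻¹ ∉ U := fun h => hy (by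
        simpa [mul_assoc] using Subgroup.Normal.conj_mem ‹U.Normal› _ h g⁻¹)
      simp [extendOne, hy, hy']
  have hout : ∀ q : G ⧸ U, ((Quotient.out q : G) : G ⧸ U) = q := Quotient.out_eq'
  have hf' : ∀ q : G ⧸ U, ((Quotient.out (q * (g : G ⧸ U)) * g⁻¹ : G) : G ⧸ U) = q := by
    intro q
    rw [QuotientGroup.mk_mul, hout, QuotientGroup.mk_inv, mul_inv_cancel_right]
  rw [transfer_eq_prod_section ϕ (fun q => Quotient.out q) hout x, map_prod]
  rw [← transfer_eq_prod_section ϕ (fun q => Quotient.out q) hout x,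
    transfer_eq_prod_section ϕ (fun q => Quotient.out (q * (g : G ⧸ U)) * g⁻¹) hf' x]
  refine (Fintype.prod_equiv (Equiv.mulRight (g : G ⧸ U)) _ _ fun q => ?_).symm
  rw [hcext]
  have hs : x⁻¹ • (q * (g : G ⧸ U)) = (x⁻¹ • q) * (g : G ⧸ U) := by
    induction q using QuotientGroup.induction_on with
    | H z => rw [← QuotientGroup.mk_mul, MulAction.Quotient.smul_coe, MulAction.Quotient.smul_coe,
        ← QuotientGroup.mk_mul, smul_eq_mul, smul_eq_mul, mul_assoc]
  simp only [Equiv.coe_mulRight, hs]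
  congr 1
  group

/-- The transfer of a continuous homomorphism on an open normal subgroup is continuous. -/
theorem continuous_transfer [TopologicalSpace G] [IsTopologicalGroup G] [TopologicalSpace B]
    [IsTopologicalGroup B] [U.FiniteIndex] [U.Normal] (hU : IsOpen (U : Set G)) (ϕ : U →* B)
    (hϕ : Continuous ϕ) : Continuous ϕ.transfer := by
  classical
  let _ := U.fintypeQuotientOfFiniteIndex
  have hout : ∀ q : G ⧸ U, ((Quotient.out q : G) : G ⧸ U) = q := Quotient.out_eq'
  have hext : ContinuousAt (extendOne ϕ) 1 := by
    have h1 : ContinuousOn (extendOne ϕ) (U : Set G) := by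
      rw [continuousOn_iff_continuous_domRestrict]
      refine hϕ.congr fun u => ?_
      simp [extendOne]
    exact h1.continuousAt (hU.mem_nhds U.one_mem)
  apply continuous_of_continuousAt_one
  have key : ContinuousAt
      (fun g : G => ∏ q : G ⧸ U, extendOne ϕ ((Quotient.out q)⁻¹ * (g * Quotient.out q))) 1 := by
    refine tendsto_finsetProd _ fun q _ => ?_
    have h2 : ContinuousAt (fun g : G => (Quotient.out q)⁻¹ * (g * Quotient.out q)) 1 := by
      fun_prop
    have h3 : ContinuousAt (extendOne ϕ) ((Quotient.out q)⁻¹ * (1 * Quotient.out q)) := by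
      simpa using hext
    exact ContinuousAt.comp (f := fun g : G => (Quotient.out q)⁻¹ * (g * Quotient.out q)) h3 h2
  refine key.congr ?_
  filter_upwards [hU.mem_nhds U.one_mem] with g hg
  rw [transfer_eq_prod_section ϕ (fun q => Quotient.out q) hout g]
  refine Finset.prod_congr rfl fun q _ => ?_
  have : g⁻¹ • q = q := by
    induction q using QuotientGroup.induction_on with
    | H z =>
      rw [MulAction.Quotient.smul_coe, QuotientGroup.eq]
      have := Subgroup.Normal.conj_mem ‹U.Normal› g hg z⁻¹
      simpa [mul_assoc] using this
  rw [this]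

end Transfer

/-! ### Discrete groups -/

section Discrete

/-- The torsion-free rank of a discrete group: the dimension of `ℚ ⊗ G^ab`. -/
def tf (G : Type*) [Group G] : ℕ :=
  Module.finrank ℚ (ℚ ⊗[ℤ] Additive (Abelianization G))

variable {G : Type*} [Group G] (U : Subgroup G)

/-- The transfer `G^ab → U^ab`. -/
def transferAb [U.FiniteIndex] : Abelianization G →* Abelianization U :=
  Abelianization.lift (MonoidHom.transfer (Abelianization.of : U →* Abelianization U))

/-- The conjugation action of `G ⧸ U` on `U^ab`. -/
def conjAb [U.Normal] : G ⧸ U →* Monoid.End (Abelianization U) :=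
  QuotientGroup.lift U
    { toFun := fun g => Abelianization.map (MulAut.conjNormal g : MulAut U).toMonoidHom
      map_one' := by
        apply Abelianization.hom_ext
        ext u
        change Abelianization.of (MulAut.conjNormal 1 u) = Abelianization.of u
        simp
      map_mul' := fun g h => by
        apply Abelianization.hom_ext
        ext u
        change Abelianization.of (MulAut.conjNormal (g * h) u) =
          Abelianization.of (MulAut.conjNormal g (MulAut.conjNormal h u))
        simp }
    (by
      intro g hg
      apply Abelianization.hom_ext
      ext u
      change Abelianization.of (MulAut.conjNormal g u) = Abelianization.of u
      have : MulAut.conjNormal g u = (⟨g, hg⟩ : U) * u * (⟨g, hg⟩ : U)⁻¹ := by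
        apply Subtype.ext; simp
      rw [this, map_mul, map_mul, mul_right_comm, ← map_mul, mul_inv_cancel, map_one, one_mul])

/-- The subgroup `(U^ab)^{G/U}` of `G ⧸ U`-invariants. -/
def invariantsAb [U.Normal] : Subgroup (Abelianization U) where
  carrier := {x | ∀ q : G ⧸ U, conjAb U q x = x}
  one_mem' := fun q => map_one (conjAb U q)
  mul_mem' := fun {x y} hx hy q => by
    rw [map_mul (conjAb U q), hx q, hy q]
  inv_mem' := fun {x} hx q => by
    rw [map_inv (conjAb U q), hx q]

theorem transferAb_mem_invariantsAb [U.FiniteIndex] [U.Normal] (x : Abelianization G) :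
    transferAb U x ∈ invariantsAb U := by
  intro q
  induction q using QuotientGroup.induction_on with
  | H g =>
    induction x using QuotientGroup.induction_on with
    | H y =>
      exact transfer_invariant (Abelianization.of : U →* Abelianization U) g
        (conjAb U (g : G ⧸ U)) (fun u => rfl) y

/-- The transfer kernel. -/
def tk [U.FiniteIndex] : Subgroup (Abelianization G) := (transferAb U).ker

/-- The transfer cokernel: the cokernel of the transfer `G^ab → (U^ab)^{G/U}`. -/
abbrev tc [U.FiniteIndex] [U.Normal] : Type _ :=
  invariantsAb U ⧸
    ((transferAb U).codRestrict (invariantsAb U) (transferAb_mem_invariantsAb U)).range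

/-- The transfer ratio `|tk| / |tc|`. -/
def rho [U.FiniteIndex] [U.Normal] : ℚ := (Nat.card (tk U) : ℚ) / Nat.card (tc U)

end Discrete

/-! ### Pro-`p` groups -/

section ProP

open Filter Topology

/-- A topological group is pro-`p` if it is profinite (compact, Hausdorff and totally
disconnected) and the index of every open normal subgroup is a power of `p`. -/
class IsProP (p : ℕ) (G : Type*) [Group G] [TopologicalSpace G] [IsTopologicalGroup G] :
    Prop where
  compact : CompactSpace G
  t2 : T2Space G
  totallyDisconnected : TotallyDisconnectedSpace G
  index_eq : ∀ V : Subgroup G, V.Normal → IsOpen (V : Set G) → ∃ n : ℕ, V.index = p ^ n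

/-- A topological group is topologically finitely generated if a finite set generates a dense
subgroup. -/
def TopologicallyFG (G : Type*) [Group G] [TopologicalSpace G] [IsTopologicalGroup G] : Prop :=
  ∃ S : Finset G, (Subgroup.closure (S : Set G)).topologicalClosure = ⊤

variable {p : ℕ}

theorem IsProP.exists_open_normal {G : Type*} [Group G] [TopologicalSpace G]
    [IsTopologicalGroup G] [hG : IsProP p G] {O : Set G} (hO : IsOpen O) (h1 : (1 : G) ∈ O) :
    ∃ V : Subgroup G, V.Normal ∧ IsOpen (V : Set G) ∧ (V : Set G) ⊆ O := by
  have := hG.compact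
  have := hG.t2
  have := hG.totallyDisconnected
  obtain ⟨H, hH⟩ := ProfiniteGrp.exist_openNormalSubgroup_sub_open_nhds_of_one hO h1
  exact ⟨H.toSubgroup, H.isNormal', H.isOpen', hH⟩

/-- A closed subgroup of a pro-`p` group is pro-`p`. -/
theorem IsProP.of_isClosed [Fact p.Prime] {G : Type*} [Group G] [TopologicalSpace G]
    [IsTopologicalGroup G] [hG : IsProP p G] (U : Subgroup G) (hU : IsClosed (U : Set G)) :
    IsProP p U where
  compact := by
    have := hG.compact
    exact isCompact_iff_compactSpace.mp hU.isCompact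
  t2 := by
    have := hG.t2
    infer_instance
  totallyDisconnected := by
    have := hG.totallyDisconnected
    exact inferInstanceAs (TotallyDisconnectedSpace (U : Set G))
  index_eq := by
    intro V _ hV
    obtain ⟨O, hO, hOV⟩ := isOpen_induced_iff.mp hV
    have h1 : (1 : G) ∈ O := by
      have : (1 : U) ∈ (Subtype.val ⁻¹' O : Set U) := by
        rw [hOV]; exact V.one_mem
      simpa using this
    obtain ⟨W, hWn, hWo, hWO⟩ := hG.exists_open_normal hO h1
    obtain ⟨n, hn⟩ := hG.index_eq W hWn hWo
    have hle : W.subgroupOf U ≤ V := by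
      intro u hu
      have : u ∈ (Subtype.val ⁻¹' O : Set U) := hWO (Subgroup.mem_subgroupOf.mp hu)
      rw [hOV] at this
      exact this
    have hd : V.index ∣ p ^ n := by
      rw [← hn]
      exact (Subgroup.index_dvd_of_le hle).trans (W.relIndex_dvd_index_of_normal U)
    obtain ⟨k, _, hk⟩ := (Nat.dvd_prime_pow Fact.out).mp hd
    exact ⟨k, hk⟩

/-! The canonical `ℤ_[p]`-module structure of an abelian pro-`p` group: `z • a` is the limit of
`mₙ • a` for any sequence of integers `mₙ` converging to `z`. -/

section PadicModule

variable {A : Type*} [AddCommGroup A] [TopologicalSpace A]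

/-- `z • a` is the limit of `mₙ • a`, with `mₙ` the `n`-th digit truncation of `z`. -/
def padicSMul [Fact p.Prime] (z : ℤ_[p]) (a : A) : A :=
  haveI : Nonempty A := ⟨0⟩
  limUnder atTop fun n : ℕ => z.appr n • a

/-- Every neighbourhood of zero contains an open subgroup `H` with `A ⧸ H` killed by a power of
`p`. -/
def HasPBasis (p : ℕ) (A : Type*) [AddCommGroup A] [TopologicalSpace A] : Prop :=
  ∀ O : Set A, IsOpen O → (0 : A) ∈ O → ∃ (H : AddSubgroup A) (n : ℕ),
    IsOpen (H : Set A) ∧ (H : Set A) ⊆ O ∧ ∀ a : A, p ^ n • a ∈ H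

variable [IsTopologicalAddGroup A]

theorem sub_mem_of_dvd {A : Type*} [AddCommGroup A] (H : AddSubgroup A) (n : ℕ) (hn : ∀ a : A, p ^ n • a ∈ H) (a : A)
    {k m : ℤ} (h : (p ^ n : ℤ) ∣ k - m) : k • a - m • a ∈ H := by
  obtain ⟨c, hc⟩ := h
  rw [← sub_smul, hc, mul_smul]
  simpa [natCast_zsmul] using (by exact_mod_cast hn (c • a) : ((p ^ n : ℕ) : ℤ) • (c • a) ∈ H)

theorem appr_sub_dvd [Fact p.Prime] (z : ℤ_[p]) {n k : ℕ} (hk : n ≤ k) {m : ℤ}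
    (hm : (p : ℤ_[p]) ^ n ∣ z - m) : (p ^ n : ℤ) ∣ (z.appr k : ℤ) - m := by
  rw [← PadicInt.pow_p_dvd_int_iff]
  have h1 := Ideal.mem_span_singleton.mp (PadicInt.appr_spec k z)
  have h2 := (pow_dvd_pow (p : ℤ_[p]) hk).trans h1
  have h3 := dvd_sub hm h2
  push_cast
  convert h3 using 1
  ring

theorem tendsto_padicSMul [Fact p.Prime] [CompactSpace A] (hA : HasPBasis p A)
    (z : ℤ_[p]) (a : A) :
    Tendsto (fun n : ℕ => z.appr n • a) atTop (𝓝 (padicSMul z a)) := by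
  have : Nonempty A := ⟨0⟩
  refine tendsto_nhds_limUnder ?_
  obtain ⟨c, hc⟩ := exists_clusterPt_of_compactSpace
    (map (fun n : ℕ => z.appr n • a) atTop)
  refine ⟨c, ?_⟩
  rw [tendsto_nhds]
  intro O hO hcO
  obtain ⟨H, n, hHo, hHO, hn⟩ := hA ((fun x => c + x) ⁻¹' O)
    (hO.preimage (continuous_const_add c)) (by simpa using hcO)
  have hopen : IsOpen ((fun x => x - c) ⁻¹' (H : Set A)) :=
    hHo.preimage (continuous_id.sub continuous_const)
  have hfreq : ∃ᶠ k in atTop, z.appr k • a - c ∈ H :=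
    (mapClusterPt_iff_frequently.mp hc) _
      (hopen.mem_nhds (by simp))
  obtain ⟨k, hk, hkc⟩ := (frequently_atTop.mp hfreq) n
  filter_upwards [eventually_ge_atTop n] with l hl
  have hd : z.appr l • a - z.appr k • a ∈ H := by
    have h1 := Ideal.mem_span_singleton.mp (PadicInt.appr_spec k z)
    have h2 := (pow_dvd_pow (p : ℤ_[p]) hk).trans h1
    have h3 := sub_mem_of_dvd H n hn a (appr_sub_dvd z hl (m := (z.appr k : ℤ))
      (by exact_mod_cast h2))
    simpa only [natCast_zsmul] using h3
  have h4 : z.appr l • a - c ∈ H := by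
    have := H.add_mem hd hkc
    simpa using this
  have h5 := hHO h4
  simpa using h5

/-- If `m ≡ z` modulo `p ^ n`, then `z • a ≡ m • a` modulo an open subgroup containing
`p ^ n • A`. -/
theorem padicSMul_sub_mem [Fact p.Prime] [CompactSpace A] (hA : HasPBasis p A)
    (H : AddSubgroup A) (hH : IsOpen (H : Set A)) (n : ℕ) (hn : ∀ a : A, p ^ n • a ∈ H)
    (z : ℤ_[p]) (m : ℤ) (hm : (p : ℤ_[p]) ^ n ∣ z - m) (a : A) :
    padicSMul z a - m • a ∈ H := by
  have hcl : IsClosed (H : Set A) := AddSubgroup.isClosed_of_isOpen H hH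
  have ht : Tendsto (fun k : ℕ => z.appr k • a - m • a) atTop (𝓝 (padicSMul z a - m • a)) :=
    (tendsto_padicSMul hA z a).sub tendsto_const_nhds
  refine hcl.mem_of_tendsto ht ?_
  filter_upwards [eventually_ge_atTop n] with k hk
  have h := sub_mem_of_dvd H n hn a (appr_sub_dvd z hk hm)
  rw [natCast_zsmul] at h
  exact h

theorem HasPBasis.eq_of_forall {A : Type*} [AddCommGroup A] [TopologicalSpace A] [T2Space A]
    (hA : HasPBasis p A) {x y : A}
    (h : ∀ (H : AddSubgroup A) (n : ℕ), IsOpen (H : Set A) → (∀ a : A, p ^ n • a ∈ H) →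
      x - y ∈ H) : x = y := by
  by_contra hxy
  obtain ⟨H, n, hHo, hHO, hn⟩ := hA {x - y}ᶜ isOpen_compl_singleton
    (by simpa [eq_comm, sub_eq_zero] using hxy)
  exact hHO (h H n hHo hn) rfl

theorem exists_int_dvd_sub [Fact p.Prime] (z : ℤ_[p]) (n : ℕ) :
    ∃ m : ℤ, (p : ℤ_[p]) ^ n ∣ z - m :=
  ⟨z.appr n, by exact_mod_cast Ideal.mem_span_singleton.mp (PadicInt.appr_spec n z)⟩

/-- The `ℤ_[p]`-module structure of an abelian pro-`p` group. -/
abbrev padicModule [Fact p.Prime] [CompactSpace A] [T2Space A] (hA : HasPBasis p A) :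
    Module ℤ_[p] A where
  smul := padicSMul
  one_smul a := hA.eq_of_forall fun H n hH hn => by
    have h := padicSMul_sub_mem hA H hH n hn 1 1 (by simp) a
    rw [one_zsmul] at h
    exact h
  mul_smul z w a := hA.eq_of_forall fun H n hH hn => by
    obtain ⟨k, hk⟩ := exists_int_dvd_sub z n
    obtain ⟨l, hl⟩ := exists_int_dvd_sub w n
    have h1 := padicSMul_sub_mem hA H hH n hn (z * w) (k * l) (by
      have := dvd_add (hk.mul_right w) (hl.mul_left (k : ℤ_[p]))
      push_cast
      convert this using 1
      ring) a
    have h2 := padicSMul_sub_mem hA H hH n hn z k hk (padicSMul w a)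
    have h3 := H.zsmul_mem (padicSMul_sub_mem hA H hH n hn w l hl a) k
    have h4 := H.sub_mem h1 (H.add_mem h2 h3)
    convert h4 using 1
    change padicSMul (z * w) a - padicSMul z (padicSMul w a) = _
    rw [zsmul_sub, mul_zsmul']
    rw [zsmul_comm]
    abel
  smul_zero z := hA.eq_of_forall fun H n hH hn => by
    obtain ⟨k, hk⟩ := exists_int_dvd_sub z n
    have h := padicSMul_sub_mem hA H hH n hn z k hk 0
    rw [zsmul_zero] at h
    exact h
  smul_add z a b := hA.eq_of_forall fun H n hH hn => by
    obtain ⟨k, hk⟩ := exists_int_dvd_sub z n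
    have h1 := padicSMul_sub_mem hA H hH n hn z k hk (a + b)
    have h2 := padicSMul_sub_mem hA H hH n hn z k hk a
    have h3 := padicSMul_sub_mem hA H hH n hn z k hk b
    convert H.sub_mem h1 (H.add_mem h2 h3) using 1
    change padicSMul z (a + b) - (padicSMul z a + padicSMul z b) = _
    rw [zsmul_add]
    abel
  add_smul z w a := hA.eq_of_forall fun H n hH hn => by
    obtain ⟨k, hk⟩ := exists_int_dvd_sub z n
    obtain ⟨l, hl⟩ := exists_int_dvd_sub w n
    have h1 := padicSMul_sub_mem hA H hH n hn (z + w) (k + l) (by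
      push_cast
      convert dvd_add hk hl using 1
      ring) a
    have h2 := padicSMul_sub_mem hA H hH n hn z k hk a
    have h3 := padicSMul_sub_mem hA H hH n hn w l hl a
    convert H.sub_mem h1 (H.add_mem h2 h3) using 1
    change padicSMul (z + w) a - (padicSMul z a + padicSMul w a) = _
    rw [add_zsmul]
    abel
  zero_smul a := hA.eq_of_forall fun H n hH hn => by
    have h := padicSMul_sub_mem hA H hH n hn 0 0 (by simp) a
    rw [zero_zsmul] at h
    exact h

end PadicModule

section TopAb

variable {G : Type*} [Group G] [TopologicalSpace G] [IsTopologicalGroup G]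

instance t2Space_topAb : T2Space (TopologicalAbelianization G) := by
  have : IsClosed ((commutator G).topologicalClosure : Set G) :=
    Subgroup.isClosed_topologicalClosure _
  infer_instance

theorem hasPBasis_topAb [hG : IsProP p G] :
    HasPBasis p (Additive (TopologicalAbelianization G)) := by
  intro O hO h0
  obtain ⟨V, hVn, hVo, hVO⟩ := hG.exists_open_normal
    (O := (fun g : G => Additive.ofMul (g : TopologicalAbelianization G)) ⁻¹' O)
    (hO.preimage (continuous_ofMul.comp QuotientGroup.continuous_mk)) h0
  obtain ⟨n, hn⟩ := hG.index_eq V hVn hVo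
  refine ⟨(V.map (QuotientGroup.mk' (commutator G).topologicalClosure)).toAddSubgroup, n,
    ?_, ?_, ?_⟩
  · exact QuotientGroup.isOpenMap_coe _ hVo
  · rintro x ⟨v, hv, rfl⟩
    exact hVO hv
  · intro a
    obtain ⟨g, hg⟩ := QuotientGroup.mk_surjective (Additive.toMul a)
    refine ⟨g ^ p ^ n, ?_, ?_⟩
    · rw [← hn]
      exact V.pow_index_mem g
    · change ((g ^ p ^ n : G) : TopologicalAbelianization G) = (Additive.toMul a) ^ p ^ n
      rw [QuotientGroup.mk_pow, hg]

/-- The canonical `ℤ_[p]`-module structure of the abelianization of a pro-`p` group. -/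
instance moduleTopAb [Fact p.Prime] [hG : IsProP p G] :
    Module ℤ_[p] (Additive (TopologicalAbelianization G)) :=
  haveI : CompactSpace G := hG.compact
  haveI : CompactSpace (Additive (TopologicalAbelianization G)) :=
    inferInstanceAs (CompactSpace (TopologicalAbelianization G))
  haveI : T2Space (Additive (TopologicalAbelianization G)) :=
    inferInstanceAs (T2Space (TopologicalAbelianization G))
  padicModule hasPBasis_topAb

/-- The torsion-free rank of a pro-`p` group: the dimension of `ℚ_[p] ⊗ G^ab`. -/
def tfProP (p : ℕ) [Fact p.Prime] (G : Type*) [Group G] [TopologicalSpace G]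
    [IsTopologicalGroup G] [IsProP p G] : ℕ :=
  Module.finrank ℚ_[p] (ℚ_[p] ⊗[ℤ_[p]] Additive (TopologicalAbelianization G))

/-- The quotient homomorphism `G → G^ab`. -/
def ofTopAb (G : Type*) [Group G] [TopologicalSpace G] [IsTopologicalGroup G] :
    G →* TopologicalAbelianization G :=
  QuotientGroup.mk' (commutator G).topologicalClosure

theorem continuous_ofTopAb : Continuous (ofTopAb G) := QuotientGroup.continuous_mk

/-- A continuous homomorphism to a Hausdorff abelian group factors through `G^ab`. -/
def liftTopAb {B : Type*} [CommGroup B] [TopologicalSpace B] [T2Space B] (f : G →* B)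
    (hf : Continuous f) : TopologicalAbelianization G →* B :=
  QuotientGroup.lift (commutator G).topologicalClosure f (by
    have h1 : commutator G ≤ f.ker := Abelianization.commutator_subset_ker f
    have h2 : IsClosed (f.ker : Set G) := isClosed_singleton.preimage hf
    exact fun x hx => Subgroup.topologicalClosure_minimal _ h1 h2 hx)

theorem topAb_hom_ext {B : Type*} [Monoid B] {f g : TopologicalAbelianization G →* B}
    (h : ∀ x : G, f (ofTopAb G x) = g (ofTopAb G x)) : f = g := by
  ext x
  exact h x

variable (U : Subgroup G)

/-- The transfer `G^ab → U^ab` for a closed normal subgroup `U` of finite index. -/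
def transferTopAb [U.FiniteIndex] [U.Normal] (hU : IsClosed (U : Set G)) :
    TopologicalAbelianization G →* TopologicalAbelianization U :=
  liftTopAb (ofTopAb U).transfer
    (continuous_transfer (U.isOpen_of_isClosed_of_finiteIndex hU) _ continuous_ofTopAb)

/-- The automorphism of `U^ab` induced by conjugation with `g`. -/
def conjTopAbAux [U.Normal] (g : G) :
    TopologicalAbelianization U →* TopologicalAbelianization U :=
  liftTopAb ((ofTopAb U).comp (MulAut.conjNormal g : MulAut U).toMonoidHom)
    (continuous_ofTopAb.comp (by
      refine Continuous.subtype_mk (f := fun u : U => g * (u : G) * g⁻¹) ?_ _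
      fun_prop))

/-- The conjugation action of `G ⧸ U` on `U^ab`. -/
def conjTopAb [U.Normal] : G ⧸ U →* Monoid.End (TopologicalAbelianization U) :=
  QuotientGroup.lift U
    { toFun := conjTopAbAux U
      map_one' := topAb_hom_ext fun u => by
        change ofTopAb U (MulAut.conjNormal 1 u) = ofTopAb U u
        simp
      map_mul' := fun g h => topAb_hom_ext fun u => by
        change ofTopAb U (MulAut.conjNormal (g * h) u) =
          ofTopAb U (MulAut.conjNormal g (MulAut.conjNormal h u))
        simp }
    (by
      intro g hg
      refine topAb_hom_ext fun u => ?_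
      change ofTopAb U (MulAut.conjNormal g u) = ofTopAb U u
      have : MulAut.conjNormal g u = (⟨g, hg⟩ : U) * u * (⟨g, hg⟩ : U)⁻¹ := by
        apply Subtype.ext; simp
      rw [this, map_mul, map_mul, mul_right_comm, ← map_mul, mul_inv_cancel, map_one, one_mul])

/-- The subgroup `(U^ab)^{G/U}` of `G ⧸ U`-invariants. -/
def invariantsTopAb [U.Normal] : Subgroup (TopologicalAbelianization U) where
  carrier := {x | ∀ q : G ⧸ U, conjTopAb U q x = x}
  one_mem' := fun q => map_one (conjTopAb U q)
  mul_mem' := fun {x y} hx hy q => by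
    rw [map_mul (conjTopAb U q), hx q, hy q]
  inv_mem' := fun {x} hx q => by
    rw [map_inv (conjTopAb U q), hx q]

theorem transferTopAb_mem_invariantsTopAb [U.FiniteIndex] [U.Normal]
    (hU : IsClosed (U : Set G)) (x : TopologicalAbelianization G) :
    transferTopAb U hU x ∈ invariantsTopAb U := by
  intro q
  induction q using QuotientGroup.induction_on with
  | H g =>
    induction x using QuotientGroup.induction_on with
    | H y =>
      exact transfer_invariant (ofTopAb U) g (conjTopAb U (g : G ⧸ U)) (fun u => rfl) y

/-- The transfer kernel. -/
def tkTop [U.FiniteIndex] [U.Normal] (hU : IsClosed (U : Set G)) :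
    Subgroup (TopologicalAbelianization G) := (transferTopAb U hU).ker

/-- The transfer cokernel: the cokernel of the transfer `G^ab → (U^ab)^{G/U}`. -/
abbrev tcTop [U.FiniteIndex] [U.Normal] (hU : IsClosed (U : Set G)) : Type _ :=
  invariantsTopAb U ⧸ ((transferTopAb U hU).codRestrict (invariantsTopAb U)
    (transferTopAb_mem_invariantsTopAb U hU)).range

/-- The transfer ratio `|tk| / |tc|`. -/
def rhoTop [U.FiniteIndex] [U.Normal] (hU : IsClosed (U : Set G)) : ℚ :=
  (Nat.card (tkTop U hU) : ℚ) / Nat.card (tcTop U hU)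

end TopAb

end ProP

end TransferRatio

end

/-! Let R be ℤ or ℤ_p, M = U^ab and A = G^ab, both finitely generated over R. Let σ be conjugation
by a generator of G/U, D = σ - 1, I = ker D the invariants, ψ : M → A the map induced by inclusion,
and T : A → I the transfer. For a homomorphism f with finite kernel and cokernel put e(f) = |ker f|
/ |coker f|; this is multiplicative under composition (`eulerRatio_comp`), and ρ = e(T).

Since G/U is cyclic, ker ψ = D(M) (`commutator_le_displacementPreimage`), and ψ(M) has index p in A.
Hence A and I have the same rank tf(G), and D(M) has rank tf(U) - tf(G). Let φ : I → A be the
restriction of ψ. Three computations give the formula: (a) T ∘ φ is multiplication by p on I, so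
e(T) e(φ) = p^(-tf(G)) (`transfer_coe_of_invariant`, `eulerRatio_mulBy`). (b) φ has the same kernel
as D restricted to D(M), and its cokernel is p times as large, so e(φ) = e(D on D(M)) / p. (c) The
norm 1 + σ + ... + σ^(p-1) kills D(M), so D(M) is a ℤ[ζ_p]-module. There (ζ_p - 1)^(p-1) is p up to
a unit, so e(D on D(M))^(p-1) = p^(-rank D(M)) (`eulerRatio_sub_one_pow`). Taking logarithms and
eliminating e(D on D(M)) yields the claim. The same multiplicativity gives finiteness of the kernel
and cokernel of T. -/

noncomputable section

namespace TransferRatio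

/-! ### Homomorphisms with finite kernel and cokernel, and the multiplicative ratio of the two
orders. -/

section EulerRatio

variable {A B C : Type*} [AddCommGroup A] [AddCommGroup B] [AddCommGroup C]

/-- A homomorphism of abelian groups with finite kernel and finite cokernel. -/
def HasFiniteKerCoker (f : A →+ B) : Prop := Nat.card f.ker ≠ 0 ∧ f.range.index ≠ 0

/-- The ratio `|ker f| / |coker f|`. -/
def eulerRatio (f : A →+ B) : ℝ := (Nat.card f.ker : ℝ) / f.range.index

theorem HasFiniteKerCoker.eulerRatio_pos {f : A →+ B} (hf : HasFiniteKerCoker f) :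
    0 < eulerRatio f :=
  div_pos (by exact_mod_cast hf.1.pos) (by exact_mod_cast hf.2.pos)

/-- The factorization of the orders of the kernels and cokernels of `f`, `g` and `g ∘ f` coming
from the kernel-cokernel exact sequence. -/
theorem exists_card_factorization (f : A →+ B) (g : B →+ C) :
    ∃ b c d : ℕ, Nat.card (g.comp f).ker = Nat.card f.ker * b ∧ Nat.card g.ker = b * c ∧
      f.range.index = c * d ∧ (g.comp f).range.index = d * g.range.index := by
  -- The witnesses are the orders of im f ∩ ker g, of ker g / (im f ∩ ker g) and of B / (im f + ker
  -- g). With infinite orders and indices counted as 0, the four identities need no finiteness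
  -- assumption.
  refine ⟨Nat.card (f.range ⊓ g.ker : AddSubgroup B), f.range.relIndex g.ker,
    (f.range ⊔ g.ker).index, ?_, ?_, ?_, ?_⟩
  · have hle : f.ker ≤ (g.comp f).ker := fun x hx => by
      simp only [AddMonoidHom.mem_ker, AddMonoidHom.comp_apply] at hx ⊢
      rw [hx, map_zero]
    have h1 := AddSubgroup.relIndex_ker f (K := (g.comp f).ker)
    have h2 : (g.comp f).ker.map f = f.range ⊓ g.ker := by
      ext y
      constructor
      · rintro ⟨x, hx, rfl⟩
        exact ⟨⟨x, rfl⟩, hx⟩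
      · rintro ⟨⟨x, rfl⟩, hx⟩
        exact ⟨x, hx, rfl⟩
    rw [← h2, ← h1, ← AddSubgroup.relIndex_bot_left, ← AddSubgroup.relIndex_bot_left,
      AddSubgroup.relIndex_mul_relIndex _ _ _ bot_le hle]
  · rw [← AddSubgroup.inf_relIndex_right, ← AddSubgroup.relIndex_bot_left,
      ← AddSubgroup.relIndex_bot_left, AddSubgroup.relIndex_mul_relIndex _ _ _ bot_le inf_le_right]
  · rw [← AddSubgroup.relIndex_sup_left, AddSubgroup.relIndex_mul_index le_sup_left]
  · rw [← AddSubgroup.index_map]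
    congr 1
    ext y
    simp [AddSubgroup.mem_map]

theorem HasFiniteKerCoker.comp {f : A →+ B} {g : B →+ C} (hg : HasFiniteKerCoker g)
    (hf : HasFiniteKerCoker f) : HasFiniteKerCoker (g.comp f) := by
  obtain ⟨b, c, d, h1, h2, h3, h4⟩ := exists_card_factorization f g
  obtain ⟨hg1, hg2⟩ := hg
  obtain ⟨hf1, hf2⟩ := hf
  rw [h2] at hg1
  rw [h3] at hf2
  refine ⟨?_, ?_⟩
  · rw [h1]; exact mul_ne_zero hf1 (left_ne_zero_of_mul hg1)
  · rw [h4]; exact mul_ne_zero (right_ne_zero_of_mul hf2) hg2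

/-- A nonzero product has nonzero factors, so finiteness is read off from the factorization. Applied
to T ∘ φ, this yields the finiteness of the transfer kernel and cokernel. -/
theorem HasFiniteKerCoker.of_comp {f : A →+ B} {g : B →+ C} (hgf : HasFiniteKerCoker (g.comp f))
    (hf : HasFiniteKerCoker f) : HasFiniteKerCoker g := by
  obtain ⟨b, c, d, h1, h2, h3, h4⟩ := exists_card_factorization f g
  obtain ⟨hg1, hg2⟩ := hgf
  obtain ⟨hf1, hf2⟩ := hf
  rw [h1] at hg1
  rw [h3] at hf2
  rw [h4] at hg2
  refine ⟨?_, right_ne_zero_of_mul hg2⟩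
  rw [h2]
  exact mul_ne_zero (right_ne_zero_of_mul hg1) (left_ne_zero_of_mul hf2)

theorem eulerRatio_comp {f : A →+ B} {g : B →+ C} (hg : HasFiniteKerCoker g)
    (hf : HasFiniteKerCoker f) : eulerRatio (g.comp f) = eulerRatio g * eulerRatio f := by
  obtain ⟨b, c, d, h1, h2, h3, h4⟩ := exists_card_factorization f g
  have hgf := hg.comp hf
  unfold eulerRatio
  rw [div_mul_div_comm, div_eq_div_iff (by exact_mod_cast hgf.2)
    (by exact_mod_cast mul_ne_zero hg.2 hf.2), h1, h2, h3, h4]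
  push_cast
  ring

theorem HasFiniteKerCoker.of_bijective {f : A →+ B} (hf : Function.Bijective f) :
    HasFiniteKerCoker f := by
  rw [HasFiniteKerCoker, (AddMonoidHom.ker_eq_bot_iff f).mpr hf.1,
    AddMonoidHom.range_eq_top.mpr hf.2]
  simp

theorem eulerRatio_of_bijective {f : A →+ B} (hf : Function.Bijective f) :
    eulerRatio f = 1 := by
  rw [eulerRatio, (AddMonoidHom.ker_eq_bot_iff f).mpr hf.1, AddMonoidHom.range_eq_top.mpr hf.2]
  simp

/-- The ratio `|ker| / |coker|` is invariant under an isogeny intertwining two endomorphisms. -/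
theorem eulerRatio_eq_of_intertwine {f : A →+ A} {g : B →+ B} {π : A →+ B}
    (hf : HasFiniteKerCoker f) (hg : HasFiniteKerCoker g) (hπ : HasFiniteKerCoker π)
    (h : π.comp f = g.comp π) : eulerRatio f = eulerRatio g := by
  have h1 := eulerRatio_comp hπ hf
  rw [h, eulerRatio_comp hg hπ, mul_comm] at h1
  exact (mul_left_cancel₀ hπ.eulerRatio_pos.ne' h1).symm

/-- Commutation serves the cokernel: the image of g ∘ f = f ∘ g lies in the image of f. -/
theorem HasFiniteKerCoker.of_comp_of_comm {f g : A →+ A} (h : g.comp f = f.comp g)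
    (hgf : HasFiniteKerCoker (g.comp f)) : HasFiniteKerCoker f := by
  constructor
  · have hle : f.ker ≤ (g.comp f).ker := fun x hx => by
      simp only [AddMonoidHom.mem_ker, AddMonoidHom.comp_apply] at hx ⊢
      rw [hx, map_zero]
    have := AddSubgroup.card_dvd_of_le hle
    exact ne_zero_of_dvd_ne_zero hgf.1 this
  · have hle : (g.comp f).range ≤ f.range := by
      rw [h]
      rintro _ ⟨x, rfl⟩
      exact ⟨g x, rfl⟩
    exact ne_zero_of_dvd_ne_zero hgf.2 (AddSubgroup.index_dvd_of_le hle)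

theorem HasFiniteKerCoker.pow {f : AddMonoid.End A} (hf : HasFiniteKerCoker f) (n : ℕ) :
    HasFiniteKerCoker (f ^ n : AddMonoid.End A) ∧
      eulerRatio (f ^ n : AddMonoid.End A) = eulerRatio f ^ n := by
  induction n with
  | zero =>
    have h : Function.Bijective (1 : AddMonoid.End A) := Function.bijective_id
    rw [pow_zero, pow_zero]
    exact ⟨.of_bijective h, eulerRatio_of_bijective h⟩
  | succ n ih =>
    rw [pow_succ, pow_succ]
    exact ⟨ih.1.comp hf, (eulerRatio_comp ih.1 hf).trans (by rw [ih.2])⟩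

end EulerRatio

/-! ### Multiplication by p on finitely generated modules. -/

section Modules

open Module nonZeroDivisors

/-- Such a module is finitely generated over the finite ring R/(a). -/
theorem finite_of_isTorsionBy {R N : Type*} [CommRing R] [Ring.HasFiniteQuotients R]
    [AddCommGroup N] [Module R N] [Module.Finite R N] {a : R} (ha : a ≠ 0)
    (h : ∀ x : N, a • x = 0) : Finite N := by
  have hI : Ideal.span {a} ≠ ⊥ := by simpa using ha
  have hfin : Finite (R ⧸ Ideal.span {a}) := Ring.HasFiniteQuotients.finiteQuotient hI
  have ht : Module.IsTorsionBySet R N (Ideal.span {a} : Ideal R) := by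
    rw [Module.isTorsionBySet_span_singleton_iff]
    exact h
  let _ := ht.module
  have : IsScalarTower R (R ⧸ Ideal.span {a}) N := ht.isScalarTower
  have : Module.Finite (R ⧸ Ideal.span {a}) N := Module.Finite.of_restrictScalars_finite R _ _
  exact Module.finite_of_finite (R ⧸ Ideal.span {a})

variable {R : Type*} [CommRing R] [Ring.HasFiniteQuotients R]

theorem finite_of_isTorsion [IsDomain R] {N : Type*} [AddCommGroup N] [Module R N] [Module.Finite R N]
    (h : Module.IsTorsion R N) : Finite N := by
  obtain ⟨a, ha, ha'⟩ := Set.nonempty_def.mp (Submodule.annihilator_top_inter_nonZeroDivisors h)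
  refine finite_of_isTorsionBy (nonZeroDivisors.ne_zero ha') fun x => ?_
  exact Submodule.mem_annihilator.mp ha x trivial

variable {M : Type*} [AddCommGroup M] [Module R M] [Module.Finite R M]

theorem hasFiniteKerCoker_of_smul_mem {N : Type*} [AddCommGroup N] [Module R N] [Module.Finite R N]
    (f : M →ₗ[R] N) {a : R} (ha : a ≠ 0) (hker : ∀ x, f x = 0 → a • x = 0)
    (hrange : ∀ y, a • y ∈ LinearMap.range f) : HasFiniteKerCoker f.toAddMonoidHom := by
  constructor
  · have : Finite (LinearMap.ker f) := finite_of_isTorsionBy ha fun x => Subtype.ext (hker x x.2)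
    have : Finite f.toAddMonoidHom.ker := this
    exact Nat.card_pos.ne'
  · have : Finite (N ⧸ LinearMap.range f) := by
      refine finite_of_isTorsionBy ha fun x => ?_
      obtain ⟨y, rfl⟩ := Submodule.Quotient.mk_surjective _ x
      rw [← Submodule.Quotient.mk_smul]
      exact (Submodule.Quotient.mk_eq_zero _).mpr (hrange y)
    have : Finite (N ⧸ f.toAddMonoidHom.range) := this
    exact AddSubgroup.index_ne_zero_of_finite

variable {p : ℕ}

/-- Multiplication by `p`, as an additive endomorphism. -/
def mulBy (p : ℕ) (M : Type*) [AddCommGroup M] : M →+ M := nsmulAddMonoidHom p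

@[simp] theorem mulBy_apply (p : ℕ) (M : Type*) [AddCommGroup M] (x : M) :
    mulBy p M x = p • x := rfl

variable (R) in
theorem hasFiniteKerCoker_mulBy (M : Type*) [AddCommGroup M] [Module R M] [Module.Finite R M]
    (hp0 : (p : R) ≠ 0) : HasFiniteKerCoker (mulBy p M) := by
  have h : mulBy p M = (LinearMap.lsmul R M (p : R)).toAddMonoidHom := by
    ext x
    simp [Nat.cast_smul_eq_nsmul]
  rw [h]
  exact hasFiniteKerCoker_of_smul_mem _ hp0 (fun x hx => hx) fun y => ⟨y, rfl⟩

/-- The kernel is trivial, and in a basis the cokernel is (R/p)^rank, of order p^rank. -/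
theorem eulerRatio_mulBy_of_free {R : Type*} [CommRing R] [IsDomain R] (M : Type*) [AddCommGroup M] [Module R M] [Module.Finite R M]
    [Module.Free R M] (hp0 : (p : R) ≠ 0) (hp : Nat.card (R ⧸ Ideal.span {(p : R)}) = p) :
    eulerRatio (mulBy p M) = ((p : ℝ) ^ finrank R M)⁻¹ := by
  let e := (Module.finBasis R M).equivFun
  let π : M →+ (Fin (finrank R M) → R ⧸ Ideal.span {(p : R)}) :=
    (AddMonoidHom.compLeft (Ideal.Quotient.mk (Ideal.span {(p : R)})).toAddMonoidHom _).comp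
      e.toLinearMap.toAddMonoidHom
  have hπ : Function.Surjective π := by
    intro y
    choose z hz using fun i => Ideal.Quotient.mk_surjective (y i)
    refine ⟨e.symm z, ?_⟩
    funext i
    simp [π, hz]
  have hk : (mulBy p M).range = π.ker := by
    ext x
    constructor
    · rintro ⟨y, rfl⟩
      rw [AddMonoidHom.mem_ker]
      funext i
      have : Ideal.Quotient.mk (Ideal.span {(p : R)}) (p : R) = 0 :=
        Ideal.Quotient.eq_zero_iff_mem.mpr (Ideal.mem_span_singleton_self _)
      simp [π, this, -map_natCast]
    · intro hx
      have h : ∀ i, ∃ z, e x i = p * z := fun i => by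
        have := congrFun (AddMonoidHom.mem_ker.mp hx) i
        exact Ideal.mem_span_singleton.mp (Ideal.Quotient.eq_zero_iff_mem.mp this)
      choose z hz using h
      refine ⟨e.symm z, e.injective ?_⟩
      funext i
      simp [hz]
  have hinj : (mulBy p M).ker = ⊥ := by
    rw [AddMonoidHom.ker_eq_bot_iff, injective_iff_map_eq_zero]
    intro x hx
    rw [mulBy_apply, ← Nat.cast_smul_eq_nsmul R] at hx
    apply e.injective
    funext i
    have := congrFun (congrArg e hx) i
    simpa [hp0] using this
  rw [eulerRatio, hinj, hk, AddSubgroup.index_ker, AddMonoidHom.range_eq_top.mpr hπ]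
  rw [AddSubgroup.card_bot, AddSubgroup.card_top, Nat.card_fun, hp]
  simp

variable [IsDomain R] [IsPrincipalIdealRing R]

/-- The torsion submodule is finite, so M and its free quotient by torsion are isogenous and
multiplication by p has the same ratio on both. -/
theorem eulerRatio_mulBy (M : Type*) [AddCommGroup M] [Module R M] [Module.Finite R M]
    (hp0 : (p : R) ≠ 0) (hp : Nat.card (R ⧸ Ideal.span {(p : R)}) = p) :
    eulerRatio (mulBy p M) = ((p : ℝ) ^ finrank R M)⁻¹ := by
  let T := Submodule.torsion R M
  have hT : Module.IsTorsion R T := Submodule.torsion_isTorsion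
  have hfin : Finite T := finite_of_isTorsion hT
  have hπ : HasFiniteKerCoker T.mkQ.toAddMonoidHom := by
    constructor
    · have : Finite T.mkQ.toAddMonoidHom.ker := by
        have h : (T.mkQ.toAddMonoidHom.ker : Set M) = T := by
          ext x; simp [AddMonoidHom.mem_ker]
        exact Finite.of_equiv T (Equiv.setCongr h.symm)
      exact Nat.card_pos.ne'
    · rw [AddMonoidHom.range_eq_top.mpr T.mkQ_surjective]
      simp
  have : Module.Free R (M ⧸ T) := inferInstance
  rw [eulerRatio_eq_of_intertwine (hasFiniteKerCoker_mulBy R M hp0)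
    (hasFiniteKerCoker_mulBy R (M ⧸ T) hp0) hπ (by ext x; simp),
    eulerRatio_mulBy_of_free (R := R) (M ⧸ T) hp0 hp]
  congr 2
  have := Submodule.finrank_quotient_add_finrank T
  rw [hT.finrank_eq_zero] at this
  simpa using this

end Modules

/-! ### Operators killed by the p-th cyclotomic polynomial. -/

section Cyclotomic

open Polynomial

/-- The product of 1 - z^k over 0 < k < p equals p, and each factor is associated to z - 1. -/
theorem associated_sub_one_pow_prime {S : Type*} [CommRing S] [IsDomain S] {p : ℕ}
    (hp : p.Prime) {z : S} (hz : IsPrimitiveRoot z p) :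
    Associated ((z - 1) ^ (p - 1)) (p : S) := by
  obtain ⟨n, rfl⟩ := Nat.exists_eq_succ_of_ne_zero hp.ne_zero
  rw [Nat.cast_succ, ← hz.prod_one_sub_pow_eq_order, Nat.succ_sub_one]
  nth_rw 1 [← Finset.card_range n]
  rw [← Finset.prod_const]
  refine Associated.prod _ _ _ fun k hk => ?_
  have hc : (k + 1).Coprime n.succ :=
    (Nat.coprime_of_lt_prime (by lia) (by simpa using hk) hp).symm
  refine (hz.associated_sub_one_pow_sub_one_of_coprime hc).trans ?_
  rw [← neg_sub]
  exact (Associated.refl _).neg_left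

/-- In `ℤ[X]`, the polynomials `(X - 1) ^ (p - 1)` and `p` agree up to a unit modulo the `p`-th
cyclotomic polynomial. -/
theorem exists_unit_mod_cyclotomic (p : ℕ) [hp : Fact p.Prime] : ∃ a b : ℤ[X],
    cyclotomic p ℤ ∣ (X - 1) ^ (p - 1) * a - (p : ℤ[X]) ∧ cyclotomic p ℤ ∣ a * b - 1 := by
  have hirr := cyclotomic.irreducible hp.out.pos
  have : IsDomain (AdjoinRoot (cyclotomic p ℤ)) := AdjoinRoot.isDomain_of_prime hirr.prime
  have hdeg : (cyclotomic p ℤ).degree ≠ 0 := (degree_cyclotomic_pos p ℤ hp.out.pos).ne'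
  have : CharZero (AdjoinRoot (cyclotomic p ℤ)) :=
    charZero_of_injective_ringHom (AdjoinRoot.of.injective_of_degree_ne_zero hdeg)
  set z := AdjoinRoot.root (cyclotomic p ℤ) with hz
  have : NeZero ((p : ℕ) : AdjoinRoot (cyclotomic p ℤ)) := ⟨by exact_mod_cast hp.out.ne_zero⟩
  have hroot : IsPrimitiveRoot z p := by
    rw [← isRoot_cyclotomic_iff, ← map_cyclotomic p (AdjoinRoot.of (cyclotomic p ℤ))]
    exact AdjoinRoot.isRoot_root _
  -- The unit relating the two elements and its inverse are lifted to polynomials a and b, which can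
  -- then be evaluated at any operator.
  obtain ⟨u, hu⟩ := associated_sub_one_pow_prime hp.out hroot
  obtain ⟨a, ha⟩ := AdjoinRoot.mk_surjective (u : AdjoinRoot (cyclotomic p ℤ))
  obtain ⟨b, hb⟩ := AdjoinRoot.mk_surjective ((u⁻¹ : _ˣ) : AdjoinRoot (cyclotomic p ℤ))
  refine ⟨a, b, ?_, ?_⟩
  · rw [← AdjoinRoot.mk_eq_mk]
    simp [ha, ← hu, hz]
  · rw [← AdjoinRoot.mk_eq_mk]
    simp [ha, hb]

open Module

/-- An operator killed by the norm polynomial acts like a primitive root of unity. -/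
theorem eulerRatio_sub_one_pow {R : Type*} [CommRing R] [IsDomain R] [Ring.HasFiniteQuotients R]
    [IsPrincipalIdealRing R] {p : ℕ} [hpr : Fact p.Prime] (hp0 : (p : R) ≠ 0)
    (hp : Nat.card (R ⧸ Ideal.span {(p : R)}) = p) {K : Type*} [AddCommGroup K] [Module R K]
    [Module.Finite R K] (s : AddMonoid.End K) (hs : ∑ i ∈ Finset.range p, s ^ i = 0) :
    HasFiniteKerCoker (s - 1 : AddMonoid.End K) ∧
      eulerRatio (s - 1 : AddMonoid.End K) ^ (p - 1) = ((p : ℝ) ^ finrank R K)⁻¹ := by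
  -- Evaluation at s gives p = (s - 1)^(p-1) · a(s) with a(s) invertible. For this s need only be
  -- additive; R enters through the ratio of multiplication by p.
  obtain ⟨a, b, ha, hb⟩ := exists_unit_mod_cyclotomic p
  have hcyc : aeval s (cyclotomic p ℤ) = 0 := by
    rw [cyclotomic_prime]
    simpa using hs
  have hdvd : ∀ f : ℤ[X], cyclotomic p ℤ ∣ f → aeval s f = 0 := by
    rintro _ ⟨c, rfl⟩
    rw [map_mul, hcyc, zero_mul]
  have h1 : (s - 1) ^ (p - 1) * aeval s a = (p : AddMonoid.End K) := by
    have := hdvd _ ha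
    rw [map_sub, map_mul, map_pow, map_sub, aeval_X, map_one, map_natCast, sub_eq_zero] at this
    exact this
  have hab : aeval s a * aeval s b = 1 := by
    have := hdvd _ hb
    rwa [map_sub, map_mul, map_one, sub_eq_zero] at this
  have hba : aeval s b * aeval s a = 1 := by
    rw [← map_mul, mul_comm, map_mul, hab]
  have hbij : Function.Bijective (aeval s a : AddMonoid.End K) :=
    Function.bijective_iff_has_inverse.mpr ⟨aeval s b, fun x => DFunLike.congr_fun hba x,
      fun x => DFunLike.congr_fun hab x⟩
  have hmul : (mulBy p K) = AddMonoidHom.comp ((s - 1) ^ (p - 1) : AddMonoid.End K)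
      (aeval s a : AddMonoid.End K) := by
    refine Eq.trans ?_ h1.symm
    ext x
    rw [mulBy_apply]
    exact (AddMonoid.End.natCast_apply p x).symm
  have hp1 := hasFiniteKerCoker_mulBy R K hp0
  have hpow : HasFiniteKerCoker ((s - 1) ^ (p - 1) : AddMonoid.End K) := by
    rw [hmul] at hp1
    exact hp1.of_comp (.of_bijective hbij)
  have hD : HasFiniteKerCoker (s - 1 : AddMonoid.End K) := by
    have h2 : (s - 1) ^ (p - 1) = (s - 1) ^ (p - 2) * (s - 1) := by
      rw [← pow_succ]
      congr 1
      have := hpr.out.two_le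
      lia
    rw [h2] at hpow
    refine HasFiniteKerCoker.of_comp_of_comm ?_ hpow
    exact (Commute.pow_self (s - 1) (p - 2))
  refine ⟨hD, ?_⟩
  rw [← (hD.pow _).2, ← eulerRatio_mulBy (R := R) K hp0 hp, hmul,
    eulerRatio_comp hpow (.of_bijective hbij), eulerRatio_of_bijective hbij, mul_one]

end Cyclotomic

/-! ### The rank formula for a module with an operator of order p. -/

section Herbrand

open Module

variable {R : Type*} [CommRing R] [IsDomain R] {M A : Type*} [AddCommGroup M] [Module R M]
  [Module.Finite R M] [AddCommGroup A] [Module R A]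

theorem finrank_range_add_finrank_ker_of_isDomain (f : M →ₗ[R] A) :
    finrank R (LinearMap.range f) + finrank R (LinearMap.ker f) = finrank R M := by
  rw [← f.quotKerEquivRange.finrank_eq, Submodule.finrank_quotient_add_finrank]

/-- The quotient is killed by its order, which is nonzero in R by characteristic zero, so it has
rank 0. -/
theorem finrank_eq_of_finite_quotient [Module.Finite R A] [CharZero R] (S : Submodule R A)
    (h : Finite (A ⧸ S)) : finrank R S = finrank R A := by
  have ht : Module.IsTorsion R (A ⧸ S) := by
    intro x
    refine ⟨⟨(Nat.card (A ⧸ S) : R), mem_nonZeroDivisors_of_ne_zero ?_⟩, ?_⟩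
    · exact_mod_cast Nat.card_pos.ne'
    · change (Nat.card (A ⧸ S) : R) • x = 0
      rw [Nat.cast_smul_eq_nsmul]
      exact card_nsmul_eq_zero'
  have := Submodule.finrank_quotient_add_finrank S
  rwa [ht.finrank_eq_zero, zero_add] at this

variable [Ring.HasFiniteQuotients R] [IsPrincipalIdealRing R] [Module.Finite R A] {p : ℕ}

/-- The rank formula for a module `M` with an operator `σ` of prime order `p`, a module `A` which
contains the coinvariants of `σ` with index `p`, and a homomorphism `T` from `A` to the
invariants `I` such that `T` composed with `I → M → A` is multiplication by `p`. -/
theorem finrank_eq_of_transfer [hpr : Fact p.Prime] [CharZero R]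
    (hp : Nat.card (R ⧸ Ideal.span {(p : R)}) = p) (σ : M →ₗ[R] M)
    (hσ : ∀ m, (σ ^ p : Module.End R M) m = m) (ψ : M →ₗ[R] A)
    (hker : ∀ m, ψ m = 0 ↔ ∃ y, σ y - y = m) (hidx : ψ.toAddMonoidHom.range.index = p)
    {I : Type*} [AddCommGroup I] (j : I →+ M) (hj : Function.Injective j)
    (hjr : ∀ m, σ m = m ↔ ∃ x, j x = m) (T : A →+ I) (hT : ∀ x, T (ψ (j x)) = p • x) :
    HasFiniteKerCoker T ∧ (finrank R M : ℝ) =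
      p * finrank R A + (1 - p) * (1 - Real.logb p (eulerRatio T)) := by
  have hp0 : (p : R) ≠ 0 := by exact_mod_cast hpr.out.ne_zero
  let D : M →ₗ[R] M := σ - 1
  have hD : ∀ m, D m = σ m - m := fun m => rfl
  have hcomm : ∀ m, D (σ m) = σ (D m) := fun m => by simp [hD]
  have hmaps : ∀ x ∈ LinearMap.range D, σ x ∈ LinearMap.range D := by
    rintro _ ⟨y, rfl⟩
    exact ⟨σ y, hcomm y⟩
  let s : AddMonoid.End (LinearMap.range D) := (σ.restrict hmaps).toAddMonoidHom
  have hspow : ∀ (i : ℕ) (x : LinearMap.range D), (((s ^ i) x : LinearMap.range D) : M) =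
      (σ ^ i : Module.End R M) x := by
    intro i
    induction i with
    | zero => intro x; simp
    | succ i ih =>
      intro x
      rw [pow_succ, pow_succ]
      exact ih (s x)
  have hssum : ∀ (n : ℕ) (x : LinearMap.range D),
      (((∑ i ∈ Finset.range n, s ^ i : AddMonoid.End _) x : LinearMap.range D) : M) =
        ∑ i ∈ Finset.range n, (σ ^ i : Module.End R M) x := by
    intro n x
    induction n with
    | zero => rfl
    | succ n ih =>
      rw [Finset.sum_range_succ, Finset.sum_range_succ, ← ih, ← hspow]
      rfl
  -- The norm kills the image of σ - 1 because their product is σ^p - 1 = 0.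
  have hsum : ∑ i ∈ Finset.range p, s ^ i = 0 := by
    ext ⟨_, y, rfl⟩
    have h1 : (∑ i ∈ Finset.range p, (σ ^ i : Module.End R M)) * (σ - 1) = σ ^ p - 1 :=
      geom_sum_mul _ _
    have h2 := DFunLike.congr_fun h1 y
    have h3 : (σ ^ p - 1 : Module.End R M) y = 0 := by
      simp [hσ]
    rw [h3] at h2
    simp only [Module.End.mul_apply, LinearMap.sum_apply] at h2
    exact (hssum p _).trans h2
  obtain ⟨hs, hsp⟩ := eulerRatio_sub_one_pow hp0 hp s hsum
  let φ : I →+ A := ψ.toAddMonoidHom.comp j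
  have hφapp : ∀ x, φ x = ψ (j x) := fun x => rfl
  have hjker : ∀ x, D (j x) = 0 := fun x => by
    rw [hD, sub_eq_zero]
    exact (hjr _).mpr ⟨x, rfl⟩
  -- Both kernels are the invariants lying in D(M) = ker ψ.
  have hcard : Nat.card φ.ker = Nat.card (s - 1 : AddMonoid.End (LinearMap.range D)).ker := by
    refine Nat.card_congr (Equiv.ofBijective (fun x => ⟨⟨j x, ?_⟩, ?_⟩) ⟨?_, ?_⟩)
    · exact (hker _).mp x.2
    · exact Subtype.ext (hjker x)
    · intro x y hxy
      exact Subtype.ext (hj (Subtype.ext_iff.mp (Subtype.ext_iff.mp hxy)))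
    · rintro ⟨⟨y, hy⟩, hy'⟩
      have hy1 : D y = 0 := congrArg Subtype.val (AddMonoidHom.mem_ker.mp hy')
      obtain ⟨x, rfl⟩ := (hjr y).mp (sub_eq_zero.mp hy1)
      exact ⟨⟨x, (hker _).mpr hy⟩, rfl⟩
  -- The index of ψ(I) in A is [M : I + ker ψ] · [A : ψ(M)] = [M : ker D + D(M)] · p, and D
  -- identifies M / (ker D + D(M)) with D(M) / D(D(M)).
  have hindex : φ.range.index =
      (s - 1 : AddMonoid.End (LinearMap.range D)).range.index * p := by
    have h1 : φ.range = j.range.map ψ.toAddMonoidHom := AddMonoidHom.range_comp _ _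
    have h2 : (s - 1 : AddMonoid.End (LinearMap.range D)).range =
        (LinearMap.range D).toAddSubgroup.map D.rangeRestrict.toAddMonoidHom := by
      ext y
      constructor
      · rintro ⟨x, rfl⟩
        exact ⟨x, x.2, Subtype.ext rfl⟩
      · rintro ⟨x, hx, rfl⟩
        exact ⟨⟨x, hx⟩, Subtype.ext rfl⟩
    have h3 : D.rangeRestrict.toAddMonoidHom.range = ⊤ :=
      AddMonoidHom.range_eq_top.mpr D.surjective_rangeRestrict
    have h4 : ψ.toAddMonoidHom.ker = (LinearMap.range D).toAddSubgroup := by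
      ext m
      exact hker m
    have h5 : D.rangeRestrict.toAddMonoidHom.ker = j.range := by
      ext m
      refine Iff.trans ?_ (hjr m)
      rw [← sub_eq_zero, ← hD, AddMonoidHom.mem_ker]
      exact Subtype.ext_iff
    rw [h1, h2, AddSubgroup.index_map, AddSubgroup.index_map, h3, h4, h5, hidx, sup_comm,
      AddSubgroup.index_top, mul_one]
  have hpne : (p : ℝ) ≠ 0 := by exact_mod_cast hpr.out.ne_zero
  have hφ : HasFiniteKerCoker φ := by
    refine ⟨?_, ?_⟩
    · rw [hcard]; exact hs.1
    · rw [hindex]; exact mul_ne_zero hs.2 hpr.out.ne_zero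
  have hφr : eulerRatio φ = eulerRatio (s - 1 : AddMonoid.End (LinearMap.range D)) / p := by
    unfold eulerRatio
    rw [hcard, hindex, div_div, Nat.cast_mul]
  -- The group I carries no module structure, so multiplication by p is measured on the isomorphic
  -- submodule `LinearMap.ker D`.
  let e : I →+ LinearMap.ker D :=
    { toFun := fun x => ⟨j x, hjker x⟩
      map_zero' := Subtype.ext (map_zero j)
      map_add' := fun x y => Subtype.ext (map_add j x y) }
  have he : Function.Bijective e := by
    refine ⟨fun x y hxy => hj (congrArg Subtype.val hxy), ?_⟩
    rintro ⟨y, hy⟩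
    obtain ⟨x, rfl⟩ := (hjr y).mp (sub_eq_zero.mp hy)
    exact ⟨x, rfl⟩
  let e' := (AddEquiv.ofBijective e he).symm
  have hcomp : (T.comp φ) = e'.toAddMonoidHom.comp ((mulBy p (LinearMap.ker D)).comp e) := by
    ext x
    apply he.1
    have : e (e' (p • e x)) = p • e x := (AddEquiv.ofBijective e he).apply_symm_apply _
    refine Eq.trans ?_ this.symm
    rw [AddMonoidHom.comp_apply, hφapp, hT, map_nsmul]
  have hpk := hasFiniteKerCoker_mulBy R (LinearMap.ker D) hp0
  have hE : HasFiniteKerCoker e := .of_bijective he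
  have hE' : HasFiniteKerCoker e'.toAddMonoidHom := .of_bijective e'.bijective
  have hTφ : HasFiniteKerCoker (T.comp φ) := by
    rw [hcomp]
    exact hE'.comp (hpk.comp hE)
  have hTf : HasFiniteKerCoker T := hTφ.of_comp hφ
  refine ⟨hTf, ?_⟩
  have hr : eulerRatio T * (eulerRatio (s - 1 : AddMonoid.End (LinearMap.range D)) / p) =
      ((p : ℝ) ^ finrank R (LinearMap.ker D))⁻¹ := by
    rw [← hφr, ← eulerRatio_comp hTf hφ, hcomp, eulerRatio_comp hE' (hpk.comp hE),
      eulerRatio_comp hpk hE, eulerRatio_of_bijective he,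
      eulerRatio_of_bijective (f := e'.toAddMonoidHom) e'.bijective,
      eulerRatio_mulBy (R := R) _ hp0 hp, mul_one, one_mul]
  have hrankM := finrank_range_add_finrank_ker_of_isDomain D
  -- The image of ψ has finite index in A, and its kernel is D(M), so rank A = rank M - rank D(M).
  have hrankA : finrank R A = finrank R (LinearMap.ker D) := by
    have h1 := finrank_range_add_finrank_ker_of_isDomain ψ
    have h2 : LinearMap.ker ψ = LinearMap.range D := by
      ext m
      exact hker m
    have : ψ.toAddMonoidHom.range.FiniteIndex := ⟨by rw [hidx]; exact hpr.out.ne_zero⟩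
    have h3 : Finite (A ⧸ ψ.toAddMonoidHom.range) := inferInstance
    have h4 := finrank_eq_of_finite_quotient (LinearMap.range ψ) h3
    rw [h2] at h1
    lia
  have hp1 : (1 : ℝ) < p := by exact_mod_cast hpr.out.one_lt
  have hlogp : Real.logb p p = 1 := Real.logb_self_eq_one hp1
  have hl1 := congrArg (Real.logb p) hr
  rw [Real.logb_mul hTf.eulerRatio_pos.ne' (div_pos hs.eulerRatio_pos (by linarith)).ne',
    Real.logb_div hs.eulerRatio_pos.ne' hpne, Real.logb_inv, Real.logb_pow, hlogp] at hl1
  have hl2 := congrArg (Real.logb p) hsp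
  rw [Real.logb_pow, Real.logb_inv, Real.logb_pow, hlogp, Nat.cast_sub hpr.out.one_le] at hl2
  rw [hrankA, ← hrankM]
  push_cast at hl2 ⊢
  -- With x = log e(s - 1), `hl2` says (p - 1) x = -rank D(M) and `hl1` says log e(T) + x - 1 =
  -- -rank ker D; x is eliminated.
  linear_combination hl2 - (p - 1 : ℝ) * hl1

end Herbrand

/-! ### Commutators and transfer for a normal subgroup of prime index. -/

section GroupTheory

variable {G : Type*} [Group G] {U : Subgroup G} {M A : Type*} [CommGroup M] [CommGroup A]

/-- The endomorphism `m ↦ φ m * m⁻¹`. -/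
def displacementHom (φ : Monoid.End M) : M →* M where
  toFun y := φ y * y⁻¹
  map_one' := by simp
  map_mul' x y := by rw [map_mul, mul_inv, mul_mul_mul_comm]

/-- The subgroup of the elements `φ m * m⁻¹`. -/
def displacement (φ : Monoid.End M) : Subgroup M := (displacementHom φ).range

theorem mem_displacement {φ : Monoid.End M} {m : M} :
    m ∈ displacement φ ↔ ∃ y, φ y * y⁻¹ = m :=
  Iff.rfl

/-- The elements of `U` whose image in `M` is a displacement of `φ`. -/
def displacementPreimage (πU : U →* M) (φ : Monoid.End M) : Subgroup G :=
  ((displacement φ).comap πU).map U.subtype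

theorem displacementPreimage_le (πU : U →* M) (φ : Monoid.End M) :
    displacementPreimage πU φ ≤ U := by
  rintro _ ⟨u, _, rfl⟩
  exact u.2

theorem coe_mem_displacementPreimage {πU : U →* M} {φ : Monoid.End M} (u : U) :
    (u : G) ∈ displacementPreimage πU φ ↔ πU u ∈ displacement φ := by
  constructor
  · rintro ⟨v, hv, hvu⟩
    rw [← Subtype.ext (a1 := v) (a2 := u) hvu]
    exact hv
  · exact fun h => ⟨u, h, rfl⟩

variable [U.Normal] {πU : U →* M} {act : G ⧸ U →* Monoid.End M}

theorem act_one_apply (m : M) : act 1 m = m := by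
  rw [map_one]
  rfl

theorem act_mul_apply (q r : G ⧸ U) (m : M) : act (q * r) m = act q (act r m) := by
  rw [map_mul]
  rfl

/-- For q = c^n the quotient telescopes into displacements of c. -/
theorem act_mul_inv_mem_displacement {c : G ⧸ U} (hc : ∀ q, q ∈ Submonoid.powers c) (q : G ⧸ U)
    (m : M) : act q m * m⁻¹ ∈ displacement (act c) := by
  obtain ⟨n, rfl⟩ := Submonoid.mem_powers_iff _ _ |>.mp (hc q)
  induction n generalizing m with
  | zero =>
    rw [pow_zero, act_one_apply, mul_inv_cancel]
    exact one_mem _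
  | succ n ih =>
    rw [pow_succ, act_mul_apply]
    have h := mul_mem (ih (act c m)) (mem_displacement.mpr ⟨m, rfl⟩)
    rwa [← mul_assoc, inv_mul_cancel_right] at h

/-- If `G ⧸ U` is finite cyclic, every commutator of `G` lies in `U`, and its image in `M` is a
displacement of the action of a generator. -/
theorem commutator_le_displacementPreimage
    (hact : ∀ (g : G) (u : U), act g (πU u) = πU (MulAut.conjNormal g u))
    {c : G ⧸ U} (hc : ∀ q, q ∈ Submonoid.powers c) :
    commutator G ≤ displacementPreimage πU (act c) := by
  have hcyc : IsCyclic (G ⧸ U) := ⟨c, fun q => by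
    obtain ⟨n, rfl⟩ := Submonoid.mem_powers_iff _ _ |>.mp (hc q)
    exact Subgroup.npow_mem_zpowers c n⟩
  have hcomm : ∀ q m, act q (act c m) = act c (act q m) := fun q m => by
    obtain ⟨n, rfl⟩ := Submonoid.mem_powers_iff _ _ |>.mp (hc q)
    rw [← act_mul_apply, ← act_mul_apply,
      (Commute.pow_self c n).eq]
  have hconj : ∀ (g : G) (u : U), g * u * g⁻¹ = (MulAut.conjNormal g u : U) := fun g u => by simp
  have hnormal : (displacementPreimage πU (act c)).Normal := by
    constructor
    rintro _ ⟨u, ⟨y, hy⟩, rfl⟩ g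
    rw [Subgroup.subtype_apply, hconj, coe_mem_displacementPreimage, ← hact, ← hy]
    refine ⟨act g y, ?_⟩
    change act c (act g y) * (act g y)⁻¹ = act g (act c y * y⁻¹)
    rw [map_mul, map_inv, hcomm]
  rw [← Subgroup.Normal.quotient_commutative_iff_commutator_le]
  -- Let L be the displacement preimage. A group with cyclic quotient by a central subgroup is
  -- abelian, so it suffices that U/L is central in G/L: a commutator of g in G with x in U maps to
  -- a displacement of a power of c.
  refine MonoidHom.isMulCommutative_of_isCyclic_of_ker_le_center
    (QuotientGroup.lift (displacementPreimage πU (act c)) (QuotientGroup.mk' U) fun x hx =>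
      (QuotientGroup.eq_one_iff x).mpr (displacementPreimage_le _ _ hx)) ?_
  intro x hx
  induction x using QuotientGroup.induction_on with
  | H x =>
    have hxU : x ∈ U := (QuotientGroup.eq_one_iff x).mp hx
    rw [Subgroup.mem_center_iff]
    intro y
    induction y using QuotientGroup.induction_on with
    | H g =>
      rw [← QuotientGroup.mk_mul, ← QuotientGroup.mk_mul, eq_comm, QuotientGroup.eq]
      have h1 : (x * g)⁻¹ * (g * x) =
          ((MulAut.conjNormal g⁻¹ (⟨x, hxU⟩⁻¹ : U) * ⟨x, hxU⟩ : U) : G) := by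
        simp [mul_assoc]
      rw [h1, coe_mem_displacementPreimage, map_mul, ← hact]
      simpa using act_mul_inv_mem_displacement (act := act) hc
        ((g⁻¹ : G) : G ⧸ U) (πU (⟨x, hxU⟩⁻¹ : U))

/-- The transfer multiplies by the index on elements with invariant image. -/
theorem transfer_coe_of_invariant [U.FiniteIndex]
    (hact : ∀ (g : G) (u : U), act g (πU u) = πU (MulAut.conjNormal g u)) (u : U)
    (hu : ∀ q, act q (πU u) = πU u) : πU.transfer (u : G) = πU u ^ U.index := by
  classical
  let _ := U.fintypeQuotientOfFiniteIndex
  have hout : ∀ q : G ⧸ U, ((Quotient.out q : G) : G ⧸ U) = q := Quotient.out_eq'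
  rw [transfer_eq_prod_section πU (fun q => Quotient.out q) hout]
  -- By normality u fixes every coset, so each factor of the transfer is the image of a conjugate of
  -- u.
  have h : ∀ q : G ⧸ U, extendOne πU ((Quotient.out q)⁻¹ * (u * Quotient.out ((u : G)⁻¹ • q))) =
      πU u := by
    intro q
    have hq : (u : G)⁻¹ • q = q := by
      induction q using QuotientGroup.induction_on with
      | H z =>
        rw [MulAction.Quotient.smul_coe, QuotientGroup.eq]
        have := Subgroup.Normal.conj_mem ‹U.Normal› u u.2 z⁻¹
        simpa [mul_assoc] using this
    have h1 : (Quotient.out q)⁻¹ * (u * Quotient.out q) =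
        (MulAut.conjNormal (Quotient.out q)⁻¹ u : U) := by simp [mul_assoc]
    rw [hq, h1, extendOne_of_mem _ (Subtype.prop _), Subtype.coe_eta, ← hact, hu]
  simp only [h, Finset.prod_const, Finset.card_univ]
  rw [Subgroup.index, Nat.card_eq_fintype_card]

open Module

/-- The rank formula for the transfer, for quotients `M` of `U` and `A` of `G` which are finitely
generated modules over a suitable principal ideal domain. -/
theorem finrank_eq_of_group_transfer {p : ℕ} [hpr : Fact p.Prime] (R : Type*) [CommRing R]
    [IsDomain R] [CharZero R] [Ring.HasFiniteQuotients R] [IsPrincipalIdealRing R]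
    (hp : Nat.card (R ⧸ Ideal.span {(p : R)}) = p)
    [Module R (Additive M)] [Module.Finite R (Additive M)]
    [Module R (Additive A)] [Module.Finite R (Additive A)] [U.FiniteIndex] (hidx : U.index = p)
    (hπU : Function.Surjective πU) {πG : G →* A} (hπG : Function.Surjective πG)
    (hact : ∀ (g : G) (u : U), act g (πU u) = πU (MulAut.conjNormal g u))
    (hker : ∀ c, commutator G ≤ displacementPreimage πU (act c) →
      πG.ker ≤ displacementPreimage πU (act c))
    (ψ : M →* A) (hψ : ∀ u : U, ψ (πU u) = πG u)
    (hactR : ∀ q (r : R) (m : Additive M), Additive.ofMul (act q (r • m).toMul) =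
      r • Additive.ofMul (act q m.toMul))
    (hψR : ∀ (r : R) (m : Additive M), Additive.ofMul (ψ (r • m).toMul) =
      r • Additive.ofMul (ψ m.toMul))
    (T : A →* M) (hT : ∀ g, T (πG g) = πU.transfer g) (I : Subgroup M)
    (hI : ∀ m, m ∈ I ↔ ∀ q, act q m = m) (hTI : ∀ a, T a ∈ I) :
    Finite T.ker ∧ Finite (I ⧸ (T.codRestrict I hTI).range) ∧
      (finrank R (Additive M) : ℝ) = p * finrank R (Additive A) + (1 - p) * (1 - Real.logb p
        (((Nat.card T.ker : ℚ) / Nat.card (I ⧸ (T.codRestrict I hTI).range) : ℚ) : ℝ)) := by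
  have hcard : Nat.card (G ⧸ U) = p := hidx
  have hnt : Nontrivial (G ⧸ U) := by
    have : Finite (G ⧸ U) := inferInstance
    rw [← Finite.one_lt_card_iff_nontrivial, hcard]
    exact hpr.out.one_lt
  obtain ⟨c, hc1⟩ := exists_ne (1 : G ⧸ U)
  have hc : ∀ q, q ∈ Submonoid.powers c := fun q => mem_powers_of_prime_card hcard hc1
  -- Here `hker` bridges the two cases: the kernel of πG is the commutator subgroup or its closure.
  have hkerL := hker c (commutator_le_displacementPreimage hact hc)
  have hcinv : ∀ m, (∀ q, act q m = m) ↔ act c m = m := by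
    intro m
    refine ⟨fun h => h c, fun h q => ?_⟩
    obtain ⟨n, rfl⟩ := Submonoid.mem_powers_iff _ _ |>.mp (hc q)
    induction n with
    | zero => simp
    | succ n ih => rw [pow_succ, act_mul_apply, h, ih]
  let σ : Additive M →ₗ[R] Additive M :=
    { toFun := fun m => Additive.ofMul (act c m.toMul)
      map_add' := fun x y => congrArg Additive.ofMul (map_mul (act c) x.toMul y.toMul)
      map_smul' := fun r m => hactR c r m }
  have hσ : ∀ m : M, σ (Additive.ofMul m) = Additive.ofMul (act c m) := fun m => rfl
  have hσpow : ∀ (n : ℕ) (m : M), (σ ^ n : Module.End R (Additive M)) (Additive.ofMul m) =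
      Additive.ofMul (act (c ^ n) m) := by
    intro n
    induction n with
    | zero => intro m; simp
    | succ n ih =>
      intro m
      rw [pow_succ, pow_succ, Module.End.mul_apply, hσ, ih, act_mul_apply]
  let ψ' : Additive M →ₗ[R] Additive A :=
    { toFun := fun m => Additive.ofMul (ψ m.toMul)
      map_add' := fun x y => congrArg Additive.ofMul (map_mul ψ x.toMul y.toMul)
      map_smul' := hψR }
  have hmain := finrank_eq_of_transfer hp σ (fun m => ?_) ψ' (fun m => ?_) ?_
    (MonoidHom.toAdditive I.subtype) (fun x y h => Subtype.ext h) (fun m => ?_)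
    (MonoidHom.toAdditive (T.codRestrict I hTI)) (fun x => ?_)
  · obtain ⟨⟨h1, h2⟩, h3⟩ := hmain
    have hk : (T.codRestrict I hTI).ker = T.ker := MonoidHom.ker_codRestrict _ _ _
    have hk' : Nat.card (MonoidHom.toAdditive (T.codRestrict I hTI)).ker = Nat.card T.ker := by
      rw [← hk]
      rfl
    have hr' : (MonoidHom.toAdditive (T.codRestrict I hTI)).range.index =
        Nat.card (I ⧸ (T.codRestrict I hTI).range) := rfl
    refine ⟨Nat.finite_of_card_ne_zero (hk' ▸ h1), Nat.finite_of_card_ne_zero (hr' ▸ h2), ?_⟩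
    rw [h3, eulerRatio, hk', hr']
    push_cast
    rfl
  · have hcp : c ^ p = 1 := by rw [← hcard]; exact pow_card_eq_one'
    have := hσpow p m.toMul
    rw [hcp, map_one] at this
    exact this
  · obtain ⟨u, hu⟩ := hπU m.toMul
    have hm : ψ' m = Additive.ofMul (πG u) := by
      rw [← hψ, hu]
      rfl
    rw [hm]
    constructor
    · intro h
      have h1 : (u : G) ∈ displacementPreimage πU (act c) := hkerL h
      rw [coe_mem_displacementPreimage, hu] at h1
      obtain ⟨y, hy⟩ := mem_displacement.mp h1
      exact ⟨Additive.ofMul y, (sub_eq_add_neg _ _).trans (congrArg Additive.ofMul hy)⟩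
    · rintro ⟨y, hy⟩
      obtain ⟨v, hv⟩ := hπU y.toMul
      obtain ⟨g, rfl⟩ := QuotientGroup.mk_surjective c
      have h1 : act g (πU v) * (πU v)⁻¹ = πU u := by
        rw [hu, hv]
        exact congrArg Additive.toMul ((sub_eq_add_neg _ _).symm.trans hy)
      have h2 : πG u = 1 := by
        rw [← hψ, ← h1, hact, map_mul, map_inv, hψ, hψ]
        simp
      rw [h2, ofMul_one]
  · have h1 : ψ'.toAddMonoidHom.range.index = ψ.range.index := rfl
    have h2 : ψ.range = U.map πG := by
      ext a
      constructor
      · rintro ⟨m, rfl⟩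
        obtain ⟨u, rfl⟩ := hπU m
        exact ⟨u, u.2, (hψ u).symm⟩
      · rintro ⟨u, hu, rfl⟩
        exact ⟨πU ⟨u, hu⟩, hψ ⟨u, hu⟩⟩
    -- The index of U survives in A because ker πG lies in U.
    rw [h1, h2, Subgroup.index_map_eq _ hπG (hkerL.trans (displacementPreimage_le _ _)), hidx]
  · have h1 : σ m = m ↔ act c m.toMul = m.toMul := Iff.rfl
    rw [h1, ← hcinv, ← hI]
    constructor
    · exact fun h => ⟨Additive.ofMul ⟨m.toMul, h⟩, rfl⟩
    · rintro ⟨x, hx⟩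
      rw [← hx]
      exact x.toMul.2
  · obtain ⟨u, hu⟩ := hπU (x.toMul : M)
    have hinv : ∀ q, act q (πU u) = πU u := by
      rw [hu]
      exact (hI _).mp x.toMul.2
    have h1 : T (ψ (x.toMul : M)) = (x.toMul : M) ^ p := by
      rw [← hu, hψ, hT, transfer_coe_of_invariant hact u hinv, hidx]
    exact congrArg Additive.ofMul (Subtype.ext h1)

end GroupTheory

/-! ### The base rings ℤ and ℤ_p. -/

section BaseRings

open Module nonZeroDivisors

/-- Localization at the nonzero divisors preserves rank, which replaces `tf` and `tfProP` by ranks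
over ℤ and ℤ_p. -/
theorem finrank_fractionRing_tensor (R K M : Type*) [CommRing R] [IsDomain R] [Field K]
    [Algebra R K] [IsFractionRing R K] [AddCommGroup M] [Module R M] :
    finrank K (K ⊗[R] M) = finrank R M := by
  have : IsLocalizedModule R⁰ (TensorProduct.mk R K M 1) :=
    (isLocalizedModule_iff_isBaseChange R⁰ K _).mpr (TensorProduct.isBaseChange R M K)
  rw [IsLocalization.finrank_eq K R⁰ le_rfl,
    IsLocalizedModule.finrank_eq R⁰ (TensorProduct.mk R K M 1) le_rfl]

theorem card_int_quotient_span (p : ℕ) : Nat.card (ℤ ⧸ Ideal.span {((p : ℕ) : ℤ)}) = p := by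
  rw [Nat.card_congr (Int.quotientSpanNatEquivZMod p).toEquiv, Nat.card_zmod]

variable (p : ℕ) [Fact p.Prime]

theorem nonempty_padicInt_quotient_equiv (n : ℕ) :
    Nonempty (ℤ_[p] ⧸ Ideal.span {(p : ℤ_[p]) ^ n} ≃ ZMod (p ^ n)) :=
  ⟨((Ideal.quotEquivOfEq (PadicInt.ker_toZModPow n).symm).trans
    (RingHom.quotientKerEquivOfSurjective (ZMod.ringHom_surjective _))).toEquiv⟩

theorem card_padicInt_quotient_span : Nat.card (ℤ_[p] ⧸ Ideal.span {(p : ℤ_[p])}) = p := by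
  obtain ⟨e⟩ := nonempty_padicInt_quotient_equiv p 1
  rw [pow_one] at e
  rw [Nat.card_congr e, Nat.card_zmod, pow_one]

instance hasFiniteQuotients_padicInt : Ring.HasFiniteQuotients ℤ_[p] where
  finiteQuotient {I} hI := by
    obtain ⟨n, rfl⟩ := PadicInt.ideal_eq_span_pow_p hI
    obtain ⟨e⟩ := nonempty_padicInt_quotient_equiv p n
    have : NeZero (p ^ n) := ⟨pow_ne_zero n (Fact.out : p.Prime).ne_zero⟩
    exact Finite.of_equiv _ e.symm

end BaseRings

/-! ### The discrete case. -/

section Discrete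

open Module

theorem finite_abelianization (G : Type*) [Group G] [Group.FG G] :
    Module.Finite ℤ (Additive (Abelianization G)) := by
  have : Group.FG (Abelianization G) := QuotientGroup.fg _
  rw [Module.Finite.iff_addGroup_fg]
  infer_instance

theorem transfer_rank_formula_discrete {p : ℕ} [Fact p.Prime] (G : Type*) [Group G] [Group.FG G]
    (U : Subgroup G) [U.Normal] [U.FiniteIndex] (hU : U.index = p) :
    Module.Finite ℚ (ℚ ⊗[ℤ] Additive (Abelianization G)) ∧
      Module.Finite ℚ (ℚ ⊗[ℤ] Additive (Abelianization U)) ∧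
      Finite (tk U) ∧ Finite (tc U) ∧
      (tf U : ℝ) = p * tf G + (1 - p) * (1 - Real.logb p (rho U)) := by
  have hG := finite_abelianization G
  have hUfin := finite_abelianization U
  refine ⟨inferInstance, inferInstance, ?_⟩
  unfold tf rho
  rw [finrank_fractionRing_tensor, finrank_fractionRing_tensor]
  exact finrank_eq_of_group_transfer (πU := Abelianization.of) (πG := Abelianization.of)
    (act := conjAb U) ℤ (card_int_quotient_span p) hU QuotientGroup.mk_surjective
    QuotientGroup.mk_surjective (fun g u => rfl)
    (fun c hc => by rwa [Abelianization.ker_of]) (Abelianization.map U.subtype)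
    (fun u => Abelianization.map_of _ _)
    (fun q r m => congrArg Additive.ofMul (map_zpow (conjAb U q) m.toMul r))
    (fun r m => congrArg Additive.ofMul (map_zpow _ m.toMul r))
    (transferAb U) (fun g => Abelianization.lift_apply_of _ _) (invariantsAb U) (fun m => Iff.rfl)
    (transferAb_mem_invariantsAb U)

end Discrete

/-! ### The pro-p case: normality, finite generation and ℤ_p-linearity. -/

section ProP

variable {p : ℕ} [hpr : Fact p.Prime]

section Normal

variable {G : Type*} [Group G] [TopologicalSpace G] [IsTopologicalGroup G]

/-- U contains an open normal V, and in the finite p-group G/V a subgroup whose index is the least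
prime factor of the order is normal. -/
theorem normal_of_index_eq_prime [hG : IsProP p G] (U : Subgroup G) [U.FiniteIndex]
    (hU : IsClosed (U : Set G)) (hidx : U.index = p) : U.Normal := by
  have hopen := U.isOpen_of_isClosed_of_finiteIndex hU
  obtain ⟨V, hVn, hVo, hVU⟩ := hG.exists_open_normal hopen U.one_mem
  obtain ⟨n, hn⟩ := hG.index_eq V hVn hVo
  have hle : V ≤ U := hVU
  have hcomap : (U.map (QuotientGroup.mk' V)).comap (QuotientGroup.mk' V) = U := by
    rw [Subgroup.comap_map_eq, QuotientGroup.ker_mk', sup_eq_left.mpr hle]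
  have hidx' : (U.map (QuotientGroup.mk' V)).index = p := by
    rw [← hidx, Subgroup.index_map_eq _ (QuotientGroup.mk'_surjective V)
      (by rwa [QuotientGroup.ker_mk'])]
  have hcard : Nat.card (G ⧸ V) = p ^ n := hn
  have hn0 : n ≠ 0 := by
    rintro rfl
    have h1 := Subgroup.index_dvd_card (U.map (QuotientGroup.mk' V))
    rw [hidx', hcard, pow_zero] at h1
    exact hpr.out.one_lt.ne' (Nat.dvd_one.mp h1)
  have : Finite (G ⧸ V) := Nat.finite_of_card_ne_zero (by
    rw [hcard]; exact pow_ne_zero n hpr.out.ne_zero)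
  have hnormal : (U.map (QuotientGroup.mk' V)).Normal :=
    Subgroup.normal_of_index_eq_minFac_card (by
      rw [hidx', hcard, Nat.pow_minFac hn0, hpr.out.minFac_eq])
  rw [← hcomap]
  exact hnormal.comap _

/-- For a dense finitely generated Γ, the subgroup Γ ∩ U has finite index in Γ, hence is finitely
generated, and it is dense in U because U is open. -/
theorem TopologicallyFG.of_isOpen (hG : TopologicallyFG G) (U : Subgroup G) [U.FiniteIndex]
    (hU : IsOpen (U : Set G)) : TopologicallyFG U := by
  obtain ⟨S, hS⟩ := hG
  let Γ := Subgroup.closure (S : Set G)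
  have : Group.FG Γ := (Group.fg_iff_subgroup_fg Γ).mpr ⟨S, rfl⟩
  let f : U.subgroupOf Γ →* Γ.subgroupOf U :=
    { toFun := fun x => ⟨⟨x, x.2⟩, (x : Γ).2⟩
      map_one' := rfl
      map_mul' := fun _ _ => rfl }
  have hf : Function.Surjective f := fun y => ⟨⟨⟨y, y.2⟩, (y : U).2⟩, rfl⟩
  have : Group.FG (Γ.subgroupOf U) := Group.fg_of_surjective hf
  obtain ⟨S', hS'⟩ := (Group.fg_iff_subgroup_fg (Γ.subgroupOf U)).mp this
  refine ⟨S', ?_⟩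
  rw [hS', eq_top_iff]
  intro u _
  rw [← SetLike.mem_coe, Subgroup.topologicalClosure_coe, mem_closure_iff]
  intro t ht hut
  obtain ⟨O, hO, rfl⟩ := isOpen_induced_iff.mp ht
  have hdense : (u : G) ∈ closure (Γ : Set G) := by
    rw [← Subgroup.topologicalClosure_coe, hS]
    trivial
  obtain ⟨γ, ⟨hγO, hγU⟩, hγ⟩ := mem_closure_iff.mp hdense (O ∩ U) (hO.inter hU) ⟨hut, u.2⟩
  exact ⟨⟨γ, hγU⟩, hγO, hγ⟩

end Normal

section PadicModule

open Filter Topology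

variable {A B : Type*} [AddCommGroup A] [TopologicalSpace A] [IsTopologicalAddGroup A]
  [CompactSpace A] [AddCommGroup B] [TopologicalSpace B] [IsTopologicalAddGroup B]
  [CompactSpace B] [T2Space B]

theorem map_padicSMul (hA : HasPBasis p A) (hB : HasPBasis p B) (f : A →+ B) (hf : Continuous f)
    (z : ℤ_[p]) (a : A) : f (padicSMul z a) = padicSMul z (f a) := by
  have h1 := (hf.tendsto _).comp (tendsto_padicSMul hA z a)
  refine tendsto_nhds_unique h1 ((tendsto_padicSMul hB z (f a)).congr fun n => ?_)
  exact (map_nsmul f _ _).symm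

/-- Scalars congruent modulo p^n act equally modulo any H containing p^n A. Together with
compactness of ℤ_p this makes finitely generated submodules closed. -/
theorem continuous_padicSMul_left (hA : HasPBasis p A) (a : A) :
    Continuous fun z : ℤ_[p] => padicSMul z a := by
  rw [continuous_iff_continuousAt]
  intro z
  rw [ContinuousAt, tendsto_nhds]
  intro O hO hzO
  obtain ⟨H, n, hHo, hHO, hn⟩ := hA ((fun x => padicSMul z a + x) ⁻¹' O)
    (hO.preimage (continuous_const_add _)) (by simpa using hzO)
  have hp0 : (0 : ℝ) < (p : ℝ) ^ (-n : ℤ) :=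
    zpow_pos (by exact_mod_cast hpr.out.pos) _
  filter_upwards [Metric.closedBall_mem_nhds z hp0] with w hw
  have hwz : (p : ℤ_[p]) ^ n ∣ w - z := by
    rw [← Ideal.mem_span_singleton, ← PadicInt.norm_le_pow_iff_mem_span_pow, ← dist_eq_norm]
    exact hw
  obtain ⟨m, hm⟩ := exists_int_dvd_sub z n
  have h1 := padicSMul_sub_mem hA H hHo n hn z m hm a
  have h2 := padicSMul_sub_mem hA H hHo n hn w m (by simpa using dvd_add hwz hm) a
  have h3 := hHO (H.sub_mem h2 h1)
  simpa using h3

end PadicModule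

section TopAb

variable {G : Type*} [Group G] [TopologicalSpace G] [IsTopologicalGroup G]

theorem continuous_liftTopAb {B : Type*} [CommGroup B] [TopologicalSpace B] [T2Space B]
    (f : G →* B) (hf : Continuous f) : Continuous (liftTopAb f hf) :=
  hf.quotient_lift _

theorem IsProP.compactSpace_topAb {p : ℕ} (hG : IsProP p G) :
    CompactSpace (TopologicalAbelianization G) :=
  have := hG.compact
  inferInstance

theorem IsProP.compactSpace_additive_topAb {p : ℕ} (hG : IsProP p G) :
    CompactSpace (Additive (TopologicalAbelianization G)) :=
  hG.compactSpace_topAb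

theorem t2Space_additive_topAb : T2Space (Additive (TopologicalAbelianization G)) :=
  t2Space_topAb (G := G)

/-- The abelianization of a finitely generated pro-`p` group is a finitely generated
`ℤ_[p]`-module. -/
theorem finite_topAb [hG : IsProP p G] (hfg : TopologicallyFG G) :
    Module.Finite ℤ_[p] (Additive (TopologicalAbelianization G)) := by
  classical
  obtain ⟨S, hS⟩ := hfg
  have := hG.compactSpace_additive_topAb
  have := t2Space_additive_topAb (G := G)
  let v : S → Additive (TopologicalAbelianization G) := fun s => Additive.ofMul (ofTopAb G s)
  refine ⟨⟨Finset.univ.image v, ?_⟩⟩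
  rw [Finset.coe_image, Finset.coe_univ, Set.image_univ]
  let F : (S → ℤ_[p]) →ₗ[ℤ_[p]] Additive (TopologicalAbelianization G) :=
    Fintype.linearCombination ℤ_[p] v
  have hF : Continuous F := by
    change Continuous fun z : S → ℤ_[p] => ∑ i, padicSMul (z i) (v i)
    exact continuous_finsetSum _ fun i _ =>
      (continuous_padicSMul_left hasPBasis_topAb (v i)).comp (continuous_apply i)
  -- The span is the continuous image of the compact ℤ_p^S, hence closed; its preimage in G is a
  -- closed subgroup containing the topological generators.
  have hclosed : IsClosed (Set.range F) := (isCompact_range hF).isClosed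
  have hrange : LinearMap.range F = Submodule.span ℤ_[p] (Set.range v) :=
    Fintype.range_linearCombination ℤ_[p] v
  have hle : Subgroup.closure (S : Set G) ≤
      (AddSubgroup.toSubgroup (LinearMap.range F).toAddSubgroup).comap (ofTopAb G) := by
    rw [Subgroup.closure_le]
    intro s hs
    change Additive.ofMul (ofTopAb G s) ∈ LinearMap.range F
    rw [hrange]
    exact Submodule.subset_span ⟨⟨s, hs⟩, rfl⟩
  have hcl : IsClosed ((fun g => Additive.ofMul (ofTopAb G g)) ⁻¹' Set.range F) :=
    hclosed.preimage (continuous_ofMul.comp continuous_ofTopAb)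
  have htop : (⊤ : Subgroup G) ≤
      (AddSubgroup.toSubgroup (LinearMap.range F).toAddSubgroup).comap (ofTopAb G) := by
    rw [← hS]
    exact Subgroup.topologicalClosure_minimal _ hle hcl
  rw [← hrange, eq_top_iff]
  intro a _
  obtain ⟨g, hg⟩ := QuotientGroup.mk_surjective a.toMul
  have h1 := htop (Subgroup.mem_top g)
  have h2 : Additive.ofMul (ofTopAb G g) = a := hg
  rw [← h2]
  exact h1

variable (U : Subgroup G)

theorem continuous_conjTopAb [U.Normal] (q : G ⧸ U) : Continuous (conjTopAb U q) := by
  induction q using QuotientGroup.induction_on with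
  | H g =>
    refine continuous_liftTopAb ((ofTopAb U).comp (MulAut.conjNormal g : MulAut U).toMonoidHom)
      (continuous_ofTopAb.comp ?_)
    exact Continuous.subtype_mk (f := fun u : U => g * (u : G) * g⁻¹) (by fun_prop) _

/-- The displacements form a continuous image of the compact U^ab. Closedness lets the inclusion of
the commutator subgroup pass to its closure. -/
theorem isClosed_displacementPreimage {p : ℕ} [U.Normal] [hUp : IsProP p U]
    (hU : IsClosed (U : Set G))
    (q : G ⧸ U) : IsClosed (displacementPreimage (ofTopAb U) (conjTopAb U q) : Set G) := by
  have := hUp.compactSpace_topAb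
  have h1 : Continuous (displacementHom (conjTopAb U q)) :=
    (continuous_conjTopAb U q).mul continuous_inv
  have h2 : IsClosed (displacement (conjTopAb U q) : Set (TopologicalAbelianization U)) :=
    (isCompact_range h1).isClosed
  exact hU.isClosedEmbedding_subtypeVal.isClosedMap _ (h2.preimage continuous_ofTopAb)

/-- The homomorphism `U^ab → G^ab` induced by the inclusion. -/
def inclusionTopAb : TopologicalAbelianization U →* TopologicalAbelianization G :=
  liftTopAb ((ofTopAb G).comp U.subtype) (continuous_ofTopAb.comp continuous_subtype_val)

/-- Unlike ℤ-linearity, ℤ_p-linearity is not automatic; continuity supplies it, since scalar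
multiples are limits of integer multiples. -/
theorem map_smul_topAb {H K : Type*} [Group H] [TopologicalSpace H] [IsTopologicalGroup H]
    [hH : IsProP p H] [Group K] [TopologicalSpace K] [IsTopologicalGroup K] [hK : IsProP p K]
    (f : TopologicalAbelianization H →* TopologicalAbelianization K) (hf : Continuous f)
    (z : ℤ_[p]) (a : Additive (TopologicalAbelianization H)) :
    Additive.ofMul (f (z • a).toMul) = z • Additive.ofMul (f a.toMul) := by
  have := hH.compactSpace_additive_topAb
  have := hK.compactSpace_additive_topAb
  have := t2Space_additive_topAb (G := K)
  exact map_padicSMul hasPBasis_topAb hasPBasis_topAb (MonoidHom.toAdditive f) hf z a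

theorem transfer_rank_formula_proP [hG : IsProP p G] [U.FiniteIndex] (hU : IsClosed (U : Set G))
    (hfg : TopologicallyFG G) (hidx : U.index = p) [hUp : IsProP p U] [U.Normal] :
    Module.Finite ℚ_[p] (ℚ_[p] ⊗[ℤ_[p]] Additive (TopologicalAbelianization G)) ∧
      Module.Finite ℚ_[p] (ℚ_[p] ⊗[ℤ_[p]] Additive (TopologicalAbelianization U)) ∧
      Finite (tkTop U hU) ∧ Finite (tcTop U hU) ∧
      (tfProP p U : ℝ) = p * tfProP p G + (1 - p) * (1 - Real.logb p (rhoTop U hU)) := by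
  have hGfin := finite_topAb (p := p) hfg
  have hUfin := finite_topAb (p := p)
    (hfg.of_isOpen U (U.isOpen_of_isClosed_of_finiteIndex hU))
  refine ⟨inferInstance, inferInstance, ?_⟩
  unfold tfProP rhoTop
  rw [finrank_fractionRing_tensor, finrank_fractionRing_tensor]
  exact finrank_eq_of_group_transfer (πU := ofTopAb U) (πG := ofTopAb G) (act := conjTopAb U)
    ℤ_[p] (card_padicInt_quotient_span p) hidx QuotientGroup.mk_surjective
    QuotientGroup.mk_surjective (fun g u => rfl)
    (fun c hc => by
      rw [ofTopAb, QuotientGroup.ker_mk']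
      exact Subgroup.topologicalClosure_minimal _ hc
        (isClosed_displacementPreimage (p := p) U hU c))
    (inclusionTopAb U) (fun u => rfl)
    (fun q r m => map_smul_topAb (conjTopAb U q) (continuous_conjTopAb U q) r m)
    (fun r m => map_smul_topAb (inclusionTopAb U) (continuous_liftTopAb _ _) r m)
    (transferTopAb U hU) (fun g => rfl) (invariantsTopAb U) (fun m => Iff.rfl)
    (transferTopAb_mem_invariantsTopAb U hU)

end TopAb

end ProP

end TransferRatio

end

open TransferRatio in
theorem theoremD (p : ℕ) [Fact p.Prime] :
    (∀ (G : Type*) [Group G] [Group.FG G] (U : Subgroup G) [U.Normal] [U.FiniteIndex],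
      U.index = p →
        Module.Finite ℚ (ℚ ⊗[ℤ] Additive (Abelianization G)) ∧
        Module.Finite ℚ (ℚ ⊗[ℤ] Additive (Abelianization U)) ∧
        Finite (tk U) ∧ Finite (tc U) ∧
        (tf U : ℝ) = p * tf G + (1 - p) * (1 - Real.logb p (rho U))) ∧
    (∀ (G : Type*) [Group G] [TopologicalSpace G] [IsTopologicalGroup G] [IsProP p G]
      (U : Subgroup G) [U.FiniteIndex] (hU : IsClosed (U : Set G)),
      TopologicallyFG G → U.index = p →
        haveI : IsProP p U := IsProP.of_isClosed U hU
        ∃ _ : U.Normal,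
          Module.Finite ℚ_[p] (ℚ_[p] ⊗[ℤ_[p]] Additive (TopologicalAbelianization G)) ∧
          Module.Finite ℚ_[p] (ℚ_[p] ⊗[ℤ_[p]] Additive (TopologicalAbelianization U)) ∧
          Finite (tkTop U hU) ∧ Finite (tcTop U hU) ∧
          (tfProP p U : ℝ) = p * tfProP p G + (1 - p) * (1 - Real.logb p (rhoTop U hU))) := by
  refine ⟨fun G _ _ U _ _ hU => transfer_rank_formula_discrete G U hU,
    fun G _ _ _ _ U _ hU hfg hidx => ?_⟩
  have : IsProP p U := IsProP.of_isClosed U hU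
  have hn : U.Normal := normal_of_index_eq_prime U hU hidx
  exact ⟨hn, transfer_rank_formula_proP U hU hfg hidx⟩
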